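/- **Theorem ($q$-right-quantum Sylvester's identity).** Let $q\in\mathbb C\setminus\{0\}$ and let $0\le n<m$ be integers. Let $\mathcal A$ be the $\mathbb C$-algebra of formal power series in the $m^2$ non-commuting variables $a_{ij}$, $1\le i,j\le m$, and let $\mathcal I$ be a two-sided ideal of $\mathcal A$ such that, modulo $\mathcal I$, the matrix $A=(a_{ij})_{1\le i,j\le m}$ is $q$-right-quantum, i.e. $$a_{jk}a_{ik}=q\,a_{ik}a_{jk}\quad (i<j),\qquad a_{ik}a_{jl}-q^{-1}a_{jk}a_{il}=a_{jl}a_{ik}-q\,a_{il}a_{jk}\quad (i<j,\ k<l)$$ (for example, the ideal generated by these relations). All the following is read in $\mathcal A/\mathcal I$. For a square matrix $M$ whose rows and columns are indexed by a finite linearly ordered set $S=\{s_1<\dots<s_k\}$ put $$\textstyle\det_q M=\sum_{\sigma\in S_k}(-q)^{-\mathrm{inv}\,\sigma}\,M_{s_{\sigma(1)}s_1}\cdots M_{s_{\sigma(k)}s_k},$$ where $\mathrm{inv}\,\sigma$ is the number of inversions of $\sigma$, and for a diagonal matrix $E=\mathrm{diag}(\varepsilon_s)_{s\in S}$ of complex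 scalars put $$\textstyle\det_q(E-M)=\sum_{J\subseteq S}\Big(\prod_{s\notin J}\varepsilon_s\Big)(-1)^{|J|}\det_q M_J,\qquad M_J=(M_{st})_{s,t\in J};$$ in particular $\det_q(I-M)=\sum_{J\subseteq S}(-1)^{|J|}\det_q M_J$. Let $A_0=(a_{ij})_{1\le i,j\le n}$, and for $i,j>n$ let $a_{i*}=(a_{i1},\dots,a_{in})$ and let $a_{*j}$ be the column $(a_{1j},\dots,a_{nj})^T$. Then $\det_q(I-A_0)$ is invertible in $\mathcal A/\mathcal I$. Define $C^q=(c^q_{ij})_{n+1\le i,j\le m}$ by $$c^q_{ij}=-\,{\textstyle\det_q}^{-1}(I-A_0)\cdot\textstyle\det_q\begin{pmatrix}I-A_0&-a_{*j}\\-a_{i*}&-a_{ij}\end{pmatrix},$$ where the last determinant is $\det_q(E-M)$ with $E=\mathrm{diag}(1,\dots,1,0)$ and $M=\begin{pmatrix}A_0&a_{*j}\\a_{i*}&a_{ij}\end{pmatrix}$, both of size $n+1$. Then $${\textstyle\det_q}^{-1}(I-A_0)\cdot{\textstyle\det_q}(I-A)={\textstyle\det_q}(I-C^q).$$ -/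

import Mathlib

/-- Formal power series in non-commuting variables `x : X` with coefficients in `K`:
arbitrary families of coefficients, one for each word in the alphabet `X`. -/
structure NCPowerSeries (X : Type*) (K : Type*) where
  coeff : List X → K

namespace NCPowerSeries

variable {X K : Type*}

@[ext] theorem ext {f g : NCPowerSeries X K} (h : ∀ w, f.coeff w = g.coeff w) : f = g := by
  cases f; cases g; congr; exact funext h

instance [Zero K] : Zero (NCPowerSeries X K) := ⟨⟨fun _ => 0⟩⟩

instance [Zero K] [One K] : One (NCPowerSeries X K) :=
  ⟨⟨fun w => match w with | [] => 1 | _ :: _ => 0⟩⟩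

instance [Add K] : Add (NCPowerSeries X K) := ⟨fun f g => ⟨fun w => f.coeff w + g.coeff w⟩⟩

instance [Neg K] : Neg (NCPowerSeries X K) := ⟨fun f => ⟨fun w => -f.coeff w⟩⟩

/-- The coefficient of `f * g` at a word `w` is the sum, over all factorizations `w = u v`,
of the products of the coefficient of `f` at `u` and the coefficient of `g` at `v`. -/
instance [Semiring K] : Mul (NCPowerSeries X K) :=
  ⟨fun f g => ⟨fun w =>
    ∑ k ∈ Finset.range (w.length + 1), f.coeff (w.take k) * g.coeff (w.drop k)⟩⟩

theorem coeff_zero [Zero K] (w : List X) : (0 : NCPowerSeries X K).coeff w = 0 := rfl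

theorem coeff_one_nil [Zero K] [One K] : (1 : NCPowerSeries X K).coeff [] = 1 := rfl

theorem coeff_one_of_ne_nil [Zero K] [One K] {w : List X} (hw : w ≠ []) :
    (1 : NCPowerSeries X K).coeff w = 0 := by
  cases w with
  | nil => exact absurd rfl hw
  | cons a l => rfl

theorem coeff_add [Add K] (f g : NCPowerSeries X K) (w : List X) :
    (f + g).coeff w = f.coeff w + g.coeff w := rfl

theorem coeff_neg [Neg K] (f : NCPowerSeries X K) (w : List X) :
    (-f).coeff w = -f.coeff w := rfl

theorem coeff_mul [Semiring K] (f g : NCPowerSeries X K) (w : List X) :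
    (f * g).coeff w =
      ∑ k ∈ Finset.range (w.length + 1), f.coeff (w.take k) * g.coeff (w.drop k) := rfl

theorem one_mul_aux [Semiring K] (f : NCPowerSeries X K) : 1 * f = f := by
  ext w
  rw [coeff_mul, Finset.sum_eq_single 0]
  · simp [coeff_one_nil]
  · intro k hk hk0
    have hw : w.take k ≠ [] := by
      intro h
      rw [List.take_eq_nil_iff] at h
      rcases h with h | h
      · exact hk0 h
      · subst h; simp at hk; omega
    rw [coeff_one_of_ne_nil hw, zero_mul]
  · simp

theorem mul_one_aux [Semiring K] (f : NCPowerSeries X K) : f * 1 = f := by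
  ext w
  rw [coeff_mul, Finset.sum_eq_single w.length]
  · simp [coeff_one_nil]
  · intro k hk hkw
    have hw : w.drop k ≠ [] := by
      intro h
      rw [List.drop_eq_nil_iff] at h
      rw [Finset.mem_range] at hk
      omega
    rw [coeff_one_of_ne_nil hw, mul_zero]
  · simp

theorem mul_assoc_aux [Semiring K] (f g h : NCPowerSeries X K) : f * g * h = f * (g * h) := by
  ext w
  simp only [coeff_mul, Finset.sum_mul, Finset.mul_sum]
  have key := Finset.sum_range_diag_flip (w.length + 1) (fun j i =>
    f.coeff (w.take j) * (g.coeff ((w.drop j).take i) * h.coeff ((w.drop j).drop i)))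
  have e1 : ∀ k ∈ Finset.range (w.length + 1),
      (∑ j ∈ Finset.range ((w.take k).length + 1),
        f.coeff ((w.take k).take j) * g.coeff ((w.take k).drop j) * h.coeff (w.drop k)) =
      ∑ j ∈ Finset.range (k + 1), f.coeff (w.take j) *
        (g.coeff ((w.drop j).take (k - j)) * h.coeff ((w.drop j).drop (k - j))) := by
    intro k hk
    rw [Finset.mem_range] at hk
    rw [List.length_take, min_eq_left (by omega)]
    refine Finset.sum_congr rfl fun j hj => ?_
    rw [Finset.mem_range] at hj
    rw [List.take_take, min_eq_left (by omega), List.drop_take, List.drop_drop, mul_assoc,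
      Nat.add_sub_cancel' (by omega)]
  rw [Finset.sum_congr rfl e1, key]
  refine Finset.sum_congr rfl fun j hj => ?_
  rw [Finset.mem_range] at hj
  rw [List.length_drop, show w.length + 1 - j = w.length - j + 1 by omega]

instance [Ring K] : Ring (NCPowerSeries X K) where
  add_assoc f g h := by ext w; simp only [coeff_add, add_assoc]
  zero_add f := by ext w; simp only [coeff_add, coeff_zero, zero_add]
  add_zero f := by ext w; simp only [coeff_add, coeff_zero, add_zero]
  add_comm f g := by ext w; simp only [coeff_add, add_comm]
  neg_add_cancel f := by ext w; simp only [coeff_add, coeff_neg, coeff_zero, neg_add_cancel]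
  left_distrib f g h := by
    ext w; simp only [coeff_mul, coeff_add, mul_add, Finset.sum_add_distrib]
  right_distrib f g h := by
    ext w; simp only [coeff_mul, coeff_add, add_mul, Finset.sum_add_distrib]
  zero_mul f := by ext w; simp [coeff_mul, coeff_zero]
  mul_zero f := by ext w; simp [coeff_mul, coeff_zero]
  one_mul := one_mul_aux
  mul_one := mul_one_aux
  mul_assoc := mul_assoc_aux
  nsmul := nsmulRec
  zsmul := zsmulRec

instance [CommRing K] : Module K (NCPowerSeries X K) where
  smul c f := ⟨fun w => c * f.coeff w⟩
  one_smul f := by ext w; exact one_mul _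
  mul_smul c d f := by ext w; exact mul_assoc _ _ _
  smul_zero c := by ext w; exact mul_zero _
  smul_add c f g := by ext w; exact mul_add _ _ _
  add_smul c d f := by ext w; exact add_mul _ _ _
  zero_smul f := by ext w; exact zero_mul _

theorem coeff_smul [CommRing K] (c : K) (f : NCPowerSeries X K) (w : List X) :
    (c • f).coeff w = c * f.coeff w := rfl

instance [CommRing K] : Algebra K (NCPowerSeries X K) :=
  Algebra.ofModule
    (fun c f g => by
      ext w; simp only [coeff_mul, coeff_smul, Finset.mul_sum, mul_assoc])
    (fun c f g => by
      ext w; simp only [coeff_mul, coeff_smul, Finset.mul_sum, mul_left_comm])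

open Classical in
/-- The variable `x`, as a power series. -/
noncomputable def var [CommRing K] (x : X) : NCPowerSeries X K :=
  ⟨fun w => if w = [x] then 1 else 0⟩

end NCPowerSeries

/-- The algebra of complex formal power series in the non-commuting variables `a_{ij}`,
`1 ≤ i, j ≤ m`. -/
abbrev SeriesAlg (m : ℕ) : Type := NCPowerSeries (Fin m × Fin m) ℂ

/-- The matrix `A = (a_{ij})` of the variables, read modulo the two-sided ideal `I`. -/
noncomputable def varMatrix {m : ℕ} (I : TwoSidedIdeal (SeriesAlg m)) :
    Matrix (Fin m) (Fin m) I.ringCon.Quotient :=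
  Matrix.of fun i j => ((NCPowerSeries.var (i, j) : SeriesAlg m) : I.ringCon.Quotient)

section Determinants

variable {R : Type*} [Ring R] [Algebra ℂ R]

/-- `A` is `q`-right-quantum. -/
def IsQRightQuantum {ι : Type*} [LinearOrder ι] (q : ℂ) (A : Matrix ι ι R) : Prop :=
  (∀ i j k, i < j → A j k * A i k = q • (A i k * A j k)) ∧
  (∀ i j k l, i < j → k < l →
    A i k * A j l - q⁻¹ • (A j k * A i l) = A j l * A i k - q • (A i l * A j k))

/-- The number of inversions of a permutation. -/
def invCount {ι : Type*} [LinearOrder ι] [Fintype ι] (σ : Equiv.Perm ι) : ℕ :=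
  (Finset.univ.filter fun p : ι × ι => p.1 < p.2 ∧ σ p.2 < σ p.1).card

/-- The `q`-determinant
`det_q M = ∑_σ (-q)^{-inv σ} M_{σ(j₁) j₁} ⋯ M_{σ(j_k) j_k}`, for a matrix indexed by the
finite linearly ordered set `j₁ < ⋯ < j_k`. -/
noncomputable def qDet {ι : Type*} [LinearOrder ι] [Fintype ι] (q : ℂ) (M : Matrix ι ι R) : R :=
  ∑ σ : Equiv.Perm ι, ((-q)⁻¹) ^ invCount σ •
    (((Finset.univ : Finset ι).sort).map fun j => M (σ j) j).prod

/-- The `q`-determinant `det_q (diag(ε) - M)` of a matrix that has both scalars and letters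
as entries. Expanding the product belonging to a permutation means choosing, for every column `j`,
the letter `-M_{σ(j) j}` or, if `σ(j) = j`, the scalar `ε_j`; a word in the letters
`M_{λ μ}` is then weighted by `q^{inv μ - inv λ}`, where only the letters
(and not the scalars) count. With `J` the set of columns where the letter is
chosen, this gives `∑_J (∏_{i ∉ J} ε_i) (-1)^{|J|} det_q M_J`. -/
noncomputable def qDetDiagSub {ι : Type*} [LinearOrder ι] [Fintype ι]
    (q : ℂ) (ε : ι → ℂ) (M : Matrix ι ι R) : R :=
  ∑ J : Finset ι, ((∏ i ∈ Jᶜ, ε i) * (-1) ^ J.card) •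
    qDet q (M.submatrix (fun i : J => (i : ι)) (fun j : J => (j : ι)))

/-- `det_q (I - M) = ∑_J (-1)^{|J|} det_q M_J`. -/
noncomputable def qDetOneSub {ι : Type*} [LinearOrder ι] [Fintype ι]
    (q : ℂ) (M : Matrix ι ι R) : R :=
  qDetDiagSub q (fun _ => 1) M

variable {m : ℕ}

/-- The upper left `n × n` block `A₀` of `A`. -/
def upperLeft (n : ℕ) (hn : n < m) (A : Matrix (Fin m) (Fin m) R) : Matrix (Fin n) (Fin n) R :=
  A.submatrix (Fin.castLE hn.le) (Fin.castLE hn.le)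

/-- The bordered matrix with block rows `(A₀, a_{*j})` and `(a_{i*}, a_{ij})`. -/
def bordered (n : ℕ) (hn : n < m) (A : Matrix (Fin m) (Fin m) R) (i j : Fin m) :
    Matrix (Fin (n + 1)) (Fin (n + 1)) R :=
  A.submatrix (Fin.snoc (α := fun _ => Fin m) (Fin.castLE hn.le) i)
    (Fin.snoc (α := fun _ => Fin m) (Fin.castLE hn.le) j)

/-- The `q`-determinant of the matrix with block rows `(I - A₀, -a_{*j})` and `(-a_{i*}, -a_{ij})`. -/
noncomputable def qDetBordered (q : ℂ) (n : ℕ) (hn : n < m) (A : Matrix (Fin m) (Fin m) R)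
    (i j : Fin m) : R :=
  qDetDiagSub q (Fin.snoc (α := fun _ => ℂ) (fun _ : Fin n => 1) 0) (bordered n hn A i j)

/-- The matrix `C^q = (c^q_{ij})`, indexed by the last `m - n` indices. -/
noncomputable def qSylvester (q : ℂ) (n : ℕ) (hn : n < m) (A : Matrix (Fin m) (Fin m) R) :
    Matrix {i : Fin m // n ≤ (i : ℕ)} {i : Fin m // n ≤ (i : ℕ)} R :=
  Matrix.of fun i j =>
    -(Ring.inverse (qDetOneSub q (upperLeft n hn A)) * qDetBordered q n hn A i j)

end Determinants

/-! The idea is to reduce to `q = 1` by a twist. Choose operators `u_i`, `v_j` on functions `ℤ^m →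
R` that commute with left multiplication by `R` and satisfy `u_j u_i = q⁻¹ u_i u_j`, `v_j v_i = q
v_i v_j` for `i < j`, and `v_i u_j = u_j v_i`. Then `(a_{ij} u_i v_j)` obeys the relations for `q =
1`, i.e. it is a Manin matrix (`isManin_twist`), and so is `X = I - (a_{ij} u_i v_j)`. Determinants
of twisted matrices at `q = 1` expand into `q`-minors times products of `u`'s and `v`'s
(`qDet_one_diagonal_sub_twist`).

For Manin matrices, `det X = det X₀₀ · det (X₁₁ - X₁₀ X₀₀⁻¹ X₀₁)` (`qDet_one_schur`): the forms `∑_i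
X_{ij} ψ_i` in Grassmann variables `ψ_i` anticommute, so column operations work as in the
commutative case.

To untwist, let the operators act on functions fixed by all `u_k v_k` with `k ≤ n` (counting from
1). There `det X₀₀` is left multiplication by `det_q(I - A₀)`. The Schur formula for the bordered
matrices of size `n + 1` then shows that the entries of the Schur complement act as `δ_{ij} - c_{ij}
u_i v_j` (`schurOp_apply`); `det X₀₀` can be cancelled because at each point of `ℤ^m` it is left
multiplication by a unit. The operators `u_i v_j` with `i, j > n` preserve the fixed functions, so
this description passes to the determinant of the Schur complement. The delta function at `0` is
fixed by every `u_k v_k`, and evaluating there gives `det_q(I - A) = det_q(I - A₀) det_q(I - C)`. No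
relations among the `c_{ij}` are needed. -/

section OrderedProducts

/-! ### Inversions and products in increasing order of the indices. -/

variable {ι κ : Type*} [LinearOrder ι] [LinearOrder κ]

/-- The number of inversions of a word. -/
def listInv : List ι → ℕ
  | [] => 0
  | a :: w => w.countP (· < a) + listInv w

/-- On its way to its sorted position, `y a` passes exactly the letters with index smaller than `a`,
and each passage costs a factor `c`. -/
theorem mul_prod_map_eq_orderedInsert {T : Type*} [Ring T] [Algebra ℂ T] {y : ι → T} {c : ℂ}
    (hy : ∀ i j, i < j → y j * y i = c • (y i * y j)) (a : ι) :
    ∀ w : List ι, w.Pairwise (· ≤ ·) → a ∉ w →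
      y a * (w.map y).prod =
        c ^ (w.countP (· < a)) • ((w.orderedInsert (· ≤ ·) a).map y).prod := by
  intro w
  induction w with
  | nil => intro _ _; simp
  | cons b l ih =>
    intro hw ha
    rw [List.mem_cons, not_or] at ha
    rw [List.pairwise_cons] at hw
    by_cases hab : a ≤ b
    · have h0 : (b :: l).countP (· < a) = 0 := by
        rw [List.countP_eq_zero]
        intro x hx
        rcases List.mem_cons.1 hx with rfl | hx
        · simpa using hab
        · simpa using hab.trans (hw.1 x hx)
      rw [h0, List.orderedInsert_cons_of_le _ _ hab]
      simp
    · have hba : b < a := not_le.1 hab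
      rw [List.orderedInsert_of_not_le _ _ hab, List.countP_cons_of_pos (by simpa using hba)]
      simp only [List.map_cons, List.prod_cons]
      rw [← mul_assoc, hy b a hba, smul_mul_assoc, mul_assoc, ih hw.2 ha.2, mul_smul_comm,
        smul_smul, pow_succ']

theorem prod_map_eq_insertionSort {T : Type*} [Ring T] [Algebra ℂ T] {y : ι → T} {c : ℂ}
    (hy : ∀ i j, i < j → y j * y i = c • (y i * y j)) :
    ∀ w : List ι, w.Nodup →
      (w.map y).prod = c ^ listInv w • ((w.insertionSort (· ≤ ·)).map y).prod := by
  intro w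
  induction w with
  | nil => intro _; simp [listInv]
  | cons a l ih =>
    intro hw
    rw [List.nodup_cons] at hw
    have hp := List.perm_insertionSort (· ≤ ·) l
    rw [List.map_cons, List.prod_cons, ih hw.2, mul_smul_comm,
      mul_prod_map_eq_orderedInsert hy a _ (List.pairwise_insertionSort _ l)
        (fun h => hw.1 (hp.mem_iff.1 h)), smul_smul, hp.countP_eq, listInv, List.insertionSort_cons,
      ← pow_add, add_comm]

theorem listInv_map (σ : ι → κ) : ∀ L : List ι, L.Pairwise (· < ·) →
    listInv (L.map σ) =
      ∑ a ∈ L.toFinset, ∑ b ∈ L.toFinset, if a < b ∧ σ b < σ a then 1 else 0 := by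
  intro L
  induction L with
  | nil => intro _; simp [listInv]
  | cons a l ih =>
    intro hL
    rw [List.pairwise_cons] at hL
    have ha : a ∉ l.toFinset := fun h => lt_irrefl _ (hL.1 a (List.mem_toFinset.1 h))
    have hnd : l.Nodup := hL.2.imp fun h => h.ne
    rw [List.map_cons, listInv, ih hL.2, List.toFinset_cons, Finset.sum_insert ha]
    simp only [Finset.sum_insert ha]
    have h1 : ∀ b ∈ l.toFinset, (if b < a ∧ σ a < σ b then 1 else 0) = 0 := fun b hb =>
      if_neg fun h => lt_asymm h.1 (hL.1 b (List.mem_toFinset.1 hb))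
    have h2 : ∀ b ∈ l.toFinset,
        (if a < b ∧ σ b < σ a then 1 else 0) = if σ b < σ a then 1 else 0 := fun b hb => by
      simp [hL.1 b (List.mem_toFinset.1 hb)]
    have h3 : l.toFinset.filter (fun b => σ b < σ a) =
        (l.filter fun b => decide (σ b < σ a)).toFinset := by
      ext; simp
    rw [if_neg (fun h => lt_irrefl _ h.1), zero_add, Finset.sum_add_distrib,
      Finset.sum_eq_zero h1, zero_add, Finset.sum_congr rfl h2, List.countP_map,
      ← Finset.card_filter, h3, List.toFinset_card_of_nodup (hnd.filter _),
      List.countP_eq_length_filter]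
    rfl

variable [Fintype ι] [Fintype κ]

theorem listInv_map_sort (σ : Equiv.Perm ι) :
    listInv ((Finset.univ : Finset ι).sort.map σ) = invCount σ := by
  rw [listInv_map _ _ (Finset.sortedLT_sort _).pairwise, Finset.sort_toFinset, invCount,
    Finset.card_filter, ← Finset.univ_product_univ, Finset.sum_product]

theorem insertionSort_map_sort (σ : Equiv.Perm ι) :
    ((Finset.univ : Finset ι).sort.map σ).insertionSort (· ≤ ·) = Finset.univ.sort := by
  refine List.Perm.eq_of_pairwise (le := (· ≤ ·)) (fun a b _ _ => le_antisymm)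
    (List.pairwise_insertionSort _ _) (Finset.pairwise_sort _ _)
    ((List.perm_insertionSort _ _).trans ?_)
  rw [List.perm_ext_iff_of_nodup
    ((List.nodup_map_iff σ.injective).2 (Finset.sort_nodup _ _)) (Finset.sort_nodup _ _)]
  intro a
  simp only [List.mem_map, Finset.mem_sort, Finset.mem_univ, true_and, iff_true]
  exact ⟨σ.symm a, by simp⟩

/-- The product of a family, in increasing order of the indices. -/
def orderedProd {T : Type*} [Ring T] (f : ι → T) : T :=
  ((Finset.univ : Finset ι).sort.map f).prod

theorem orderedProd_perm {T : Type*} [Ring T] [Algebra ℂ T] {y : ι → T} {c : ℂ}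
    (hy : ∀ i j, i < j → y j * y i = c • (y i * y j)) (σ : Equiv.Perm ι) :
    orderedProd (fun j => y (σ j)) = c ^ invCount σ • orderedProd y := by
  have h := prod_map_eq_insertionSort hy ((Finset.univ : Finset ι).sort.map σ)
    ((List.nodup_map_iff σ.injective).2 (Finset.sort_nodup _ _))
  rw [listInv_map_sort, insertionSort_map_sort, List.map_map] at h
  exact h

theorem sort_univ_eq {L : List ι} (hL : L.Pairwise (· < ·)) (hm : ∀ a, a ∈ L) :
    (Finset.univ : Finset ι).sort = L :=
  (Finset.sortedLT_sort _).eq_of_mem_iff hL.sortedLT (by simp [hm])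

/-- The ordered product as a multilinear map. -/
def orderedProdMultilinear (ι T : Type*) [LinearOrder ι] [Fintype ι] [Ring T] [Algebra ℂ T] :
    MultilinearMap ℂ (fun _ : ι => T) T :=
  MultilinearMap.mk' orderedProd
    (fun m i x y => by
      have hi : (Finset.univ : Finset ι).sort.idxOf i < Fintype.card ι := by
        simpa using List.idxOf_lt_length_of_mem ((Finset.mem_sort (· ≤ ·)).2 (Finset.mem_univ i))
      simp [orderedProd, (Finset.sort_nodup (Finset.univ : Finset ι) (· ≤ ·)).map_update,
        List.prod_set, hi, add_mul, mul_add])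
    (fun m i c x => by
      have hi : (Finset.univ : Finset ι).sort.idxOf i < Fintype.card ι := by
        simpa using List.idxOf_lt_length_of_mem ((Finset.mem_sort (· ≤ ·)).2 (Finset.mem_univ i))
      simp [orderedProd, (Finset.sort_nodup (Finset.univ : Finset ι) (· ≤ ·)).map_update,
        List.prod_set, hi])

theorem orderedProd_sum {T : Type*} [Ring T] [Algebra ℂ T] {α : Type*} [Fintype α]
    (g : ι → α → T) :
    orderedProd (fun i => ∑ j, g i j) = ∑ r : ι → α, orderedProd fun i => g i (r i) :=
  (orderedProdMultilinear ι T).map_sum g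

theorem orderedProd_add {T : Type*} [Ring T] [Algebra ℂ T] (f g : ι → T) :
    orderedProd (f + g) = ∑ s : Finset ι, orderedProd (s.piecewise f g) :=
  (orderedProdMultilinear ι T).map_add_univ f g

theorem orderedProd_smul {T : Type*} [Ring T] [Algebra ℂ T] (c : ι → ℂ) (f : ι → T) :
    orderedProd (fun i => c i • f i) = (∏ i, c i) • orderedProd f :=
  (orderedProdMultilinear ι T).map_smul_univ c f

theorem list_prod_map_mul {T α : Type*} [Ring T] {f g : α → T} (L : List α)
    (h : ∀ i j, g i * f j = f j * g i) :
    (L.map fun i => f i * g i).prod = (L.map f).prod * (L.map g).prod := by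
  induction L with
  | nil => simp
  | cons a l ih =>
    have hc : ∀ l : List α, g a * (l.map f).prod = (l.map f).prod * g a := by
      intro l
      induction l with
      | nil => simp
      | cons b l ih =>
        rw [List.map_cons, List.prod_cons, ← mul_assoc, h, mul_assoc, ih, mul_assoc]
    simp only [List.map_cons, List.prod_cons, ih]
    rw [mul_assoc, ← mul_assoc (g a), hc, mul_assoc, mul_assoc]

theorem orderedProd_mul {T : Type*} [Ring T] {f g : ι → T}
    (h : ∀ i j, g i * f j = f j * g i) :
    orderedProd (fun i => f i * g i) = orderedProd f * orderedProd g :=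
  list_prod_map_mul _ h

theorem map_orderedProd {T T' F : Type*} [Ring T] [Ring T'] [FunLike F T T']
    [RingHomClass F T T'] (φ : F) (f : ι → T) :
    φ (orderedProd f) = orderedProd fun i => φ (f i) := by
  rw [orderedProd, orderedProd, map_list_prod, List.map_map]; rfl

theorem orderedProd_orderIso {T : Type*} [Ring T] (e : ι ≃o κ) (f : κ → T) :
    orderedProd (fun i => f (e i)) = orderedProd f := by
  have h : (Finset.univ : Finset κ).sort = Finset.univ.sort.map e :=
    sort_univ_eq (List.Pairwise.map _ (fun a b hab => e.lt_iff_lt.2 hab)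
      (Finset.sortedLT_sort _).pairwise)
      (fun a => List.mem_map.2 ⟨e.symm a, by simp⟩)
  rw [orderedProd, orderedProd, h, List.map_map]; rfl

end OrderedProducts

/-! ### The `q`-determinant and anticommuting variables. -/

section QDet

variable {ι κ : Type*} [LinearOrder ι] [LinearOrder κ] [Fintype ι] [Fintype κ]
  {R : Type*} [Ring R] [Algebra ℂ R]

theorem qDet_eq (q : ℂ) (M : Matrix ι ι R) :
    qDet q M = ∑ σ : Equiv.Perm ι, ((-q)⁻¹) ^ invCount σ • orderedProd fun j => M (σ j) j := rfl

theorem map_qDet {R' : Type*} [Ring R'] [Algebra ℂ R'] (φ : R →ₐ[ℂ] R') (q : ℂ)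
    (M : Matrix ι ι R) : φ (qDet q M) = qDet q (M.map φ) := by
  simp only [qDet_eq, map_sum, map_smul, map_orderedProd, Matrix.map_apply]

theorem invCount_orderIso (e : ι ≃o κ) (σ : Equiv.Perm κ) :
    invCount ((e.toEquiv.trans σ).trans e.symm.toEquiv) = invCount σ := by
  rw [invCount, invCount]
  refine Finset.card_equiv (e.toEquiv.prodCongr e.toEquiv) ?_
  rintro ⟨a, b⟩
  simp

theorem qDet_orderIso (q : ℂ) (e : ι ≃o κ) (M : Matrix κ κ R) :
    qDet q (M.submatrix e e) = qDet q M := by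
  rw [qDet_eq, qDet_eq]
  refine (Fintype.sum_equiv e.toEquiv.permCongr.symm _ _ fun σ => ?_).symm
  have h : e.toEquiv.permCongr.symm σ = (e.toEquiv.trans σ).trans e.symm.toEquiv := by
    ext x; simp [Equiv.permCongr]
  rw [h, invCount_orderIso]
  congr 1
  rw [← orderedProd_orderIso e]
  simp

theorem prod_map_eq_zero_of_not_nodup {T α : Type*} [Ring T] {y : α → T}
    (hy : ∀ i j, y j * y i = -(y i * y j)) (hy2 : ∀ i, y i * y i = 0) :
    ∀ w : List α, ¬ w.Nodup → (w.map y).prod = 0 := by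
  have aux : ∀ (a : α) (w : List α), a ∈ w → y a * (w.map y).prod = 0 := by
    intro a w
    induction w with
    | nil => intro h; simp at h
    | cons b l ih =>
      intro h
      rw [List.map_cons, List.prod_cons, ← mul_assoc]
      rcases List.mem_cons.1 h with rfl | h
      · rw [hy2, zero_mul]
      · rw [hy b a, neg_mul, mul_assoc, ih h, mul_zero, neg_zero]
  intro w
  induction w with
  | nil => intro h; simp at h
  | cons a l ih =>
    intro h
    rw [List.map_cons, List.prod_cons]
    by_cases hl : l.Nodup
    · exact aux a l (by by_contra h'; exact h (List.nodup_cons.2 ⟨h', hl⟩))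
    · rw [ih hl, mul_zero]

theorem neg_one_inv_smul {T : Type*} [Ring T] [Algebra ℂ T] (x : T) :
    (-(1 : ℂ))⁻¹ • x = -x := by
  rw [inv_neg, inv_one, neg_one_smul]

/-- The coefficient of a product of linear forms in anticommuting variables. -/
theorem orderedProd_linearForms {T : Type*} [Ring T] [Algebra ℂ T] {y : ι → T}
    (hy : ∀ i j, y j * y i = -(y i * y j)) (hy2 : ∀ i, y i * y i = 0)
    (ρ : R →ₐ[ℂ] T) (hρ : ∀ r i, y i * ρ r = ρ r * y i) (M : Matrix ι ι R) :
    orderedProd (fun l => ∑ i, ρ (M i l) * y i) = ρ (qDet 1 M) * orderedProd y := by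
  rw [orderedProd_sum]
  have hsplit : ∀ p : ι → ι, (orderedProd fun l => ρ (M (p l) l) * y (p l)) =
      ρ (orderedProd fun l => M (p l) l) * orderedProd fun l => y (p l) := fun p => by
    rw [map_orderedProd, orderedProd_mul (fun i j => hρ _ _)]
  simp only [hsplit]
  -- A repeated index kills the product, so of all index functions only the permutations survive.
  have hzero : ∀ p : ι → ι, ¬ Function.Bijective p → (orderedProd fun l => y (p l)) = 0 := by
    intro p hp
    have h := prod_map_eq_zero_of_not_nodup hy hy2 ((Finset.univ : Finset ι).sort.map p) (by
      rw [List.nodup_map_iff_inj_on (Finset.sort_nodup _ _)]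
      intro h
      exact hp (Finite.injective_iff_bijective.1 fun a b => h a (by simp) b (by simp)))
    rw [List.map_map] at h
    exact h
  have hy' : ∀ i j, i < j → y j * y i = (-(1 : ℂ))⁻¹ • (y i * y j) := fun i j _ => by
    rw [neg_one_inv_smul, hy]
  rw [qDet_eq, map_sum, Finset.sum_mul]
  symm
  refine Finset.sum_of_injOn (fun σ : Equiv.Perm ι => (σ : ι → ι))
    (fun _ _ _ _ h => DFunLike.coe_injective h) (by simp) ?_ ?_
  · intro p _ hp
    rw [hzero p, mul_zero]
    exact fun hb => hp ⟨Equiv.ofBijective p hb, by simp, rfl⟩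
  · intro σ _
    rw [orderedProd_perm hy' σ, map_smul, smul_mul_assoc, mul_smul_comm]

end QDet

/-! ### Expansion of determinants at `q = 1` and the effect of the twist. -/

section Expansion

variable {ι : Type*} [LinearOrder ι] [Fintype ι]

/-- Extending a permutation of a subset by fixed points can change its number of inversions but not
its sign; the expansion along subsets below relies on this. -/
theorem sign_eq_neg_one_pow_invCount (σ : Equiv.Perm ι) :
    ((Equiv.Perm.sign σ : ℤ) : ℂ) = (-1) ^ invCount σ := by
  let e := Fintype.orderIsoFinOfCardEq ι rfl
  have h1 := invCount_orderIso e σ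
  have h2 : Equiv.Perm.sign ((e.toEquiv.trans σ).trans e.symm.toEquiv) = Equiv.Perm.sign σ :=
    Equiv.Perm.sign_trans_trans_symm σ e.toEquiv
  rw [← h1, ← h2]
  generalize (e.toEquiv.trans σ).trans e.symm.toEquiv = τ
  have h3 : invCount τ = ∑ j, ∑ i ∈ Finset.Iio j, if τ i < τ j then 0 else 1 := by
    rw [invCount, Finset.card_filter, ← Finset.univ_product_univ, Finset.sum_product,
      Finset.sum_comm]
    refine Finset.sum_congr rfl fun j _ => ?_
    rw [← Finset.sum_subset (Finset.subset_univ (Finset.Iio j))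
      (fun i _ hi => if_neg fun h => hi (Finset.mem_Iio.2 h.1))]
    refine Finset.sum_congr rfl fun i hi => ?_
    have hij := Finset.mem_Iio.1 hi
    have hne : τ i ≠ τ j := fun h => hij.ne (τ.injective h)
    by_cases h : τ i < τ j
    · simp [h, h.le]
    · simp [h, hij, lt_of_le_of_ne (not_lt.1 h) hne.symm]
  rw [Equiv.Perm.sign_eq_prod_prod_Iio, h3, ← Finset.prod_pow_eq_pow_sum]
  push_cast
  refine Finset.prod_congr rfl fun j _ => ?_
  rw [← Finset.prod_pow_eq_pow_sum]
  refine Finset.prod_congr rfl fun i _ => ?_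
  split_ifs <;> simp

variable {S : Type*} [Ring S]

theorem sort_univ_filter_mem (s : Finset ι) :
    (Finset.univ : Finset ι).sort.filter (· ∈ s) =
      (Finset.univ : Finset s).sort.map (fun i : s => (i : ι)) := by
  refine List.SortedLT.eq_of_mem_iff
    ((Finset.sortedLT_sort _).pairwise.filter _).sortedLT
    (List.Pairwise.map (fun i : s => (i : ι)) (fun _ _ h => h) (Finset.sortedLT_sort _).pairwise).sortedLT ?_
  intro a
  simp

theorem orderedProd_piecewise_one (s : Finset ι) (b : ι → S) :
    orderedProd (s.piecewise b 1) = orderedProd fun i : s => b i := by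
  have h : ∀ L : List ι, (L.map (s.piecewise b 1)).prod = ((L.filter (· ∈ s)).map b).prod := by
    intro L
    induction L with
    | nil => rfl
    | cons a l ih => by_cases ha : a ∈ s <;> simp [ha, ih]
  rw [orderedProd, h, sort_univ_filter_mem, List.map_map]
  rfl

variable [Algebra ℂ S]

theorem qDet_one_eq (M : Matrix ι ι S) :
    qDet 1 M = ∑ σ : Equiv.Perm ι,
      ((Equiv.Perm.sign σ : ℤ) : ℂ) • orderedProd fun j => M (σ j) j := by
  simp only [qDet_eq, sign_eq_neg_one_pow_invCount, inv_neg, inv_one]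

theorem orderedProd_piecewise_smul_one (s : Finset ι) (b : ι → S) (c : ι → ℂ) :
    orderedProd (s.piecewise (-b) (fun i => c i • (1 : S))) =
      ((∏ i ∈ sᶜ, c i) * (-1) ^ s.card) • orderedProd fun i : s => b i := by
  have h : s.piecewise (-b) (fun i => c i • (1 : S)) =
      fun i => s.piecewise (fun _ => -1) c i • s.piecewise b 1 i := by
    funext i
    by_cases hi : i ∈ s <;> simp [hi]
  rw [h, orderedProd_smul, orderedProd_piecewise_one, Finset.prod_piecewise]
  simp [Finset.compl_eq_univ_sdiff, mul_comm]

/-- Split every column into letter plus scalar. If letters are chosen in the columns `s`, a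
permutation moving a point outside `s` meets a zero scalar; the others are permutations of `s`
extended by the identity, with the same sign. -/
theorem qDet_one_diagonal_sub (ε : ι → ℂ) (B : Matrix ι ι S) :
    qDet 1 (Matrix.diagonal (fun i => ε i • (1 : S)) - B) = qDetDiagSub 1 ε B := by
  have h1 : ∀ σ : Equiv.Perm ι,
      (orderedProd fun j => (Matrix.diagonal (fun i => ε i • (1 : S)) - B) (σ j) j) =
        ∑ s : Finset ι, ((∏ i ∈ sᶜ, if σ i = i then ε i else 0) * (-1) ^ s.card) •
          orderedProd fun i : s => B (σ i) i := fun σ => by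
    have hadd : (fun j => (Matrix.diagonal (fun i => ε i • (1 : S)) - B) (σ j) j) =
        -(fun j => B (σ j) j) + fun j => (if σ j = j then ε j else 0) • (1 : S) := by
      funext j
      by_cases hj : σ j = j
      · simp [hj, sub_eq_neg_add]
      · simp [hj, sub_eq_neg_add]
    rw [hadd, orderedProd_add]
    exact Finset.sum_congr rfl fun s _ => orderedProd_piecewise_smul_one s _ _
  rw [qDet_one_eq, qDetDiagSub]
  simp only [h1, Finset.smul_sum]
  rw [Finset.sum_comm]
  refine Finset.sum_congr rfl fun s _ => ?_
  rw [qDet_one_eq, Finset.smul_sum]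
  symm
  refine Finset.sum_of_injOn (fun σ : Equiv.Perm s => Equiv.Perm.ofSubtype σ)
    (fun _ _ _ _ h => Equiv.Perm.ofSubtype_injective h) (by simp) ?_ ?_
  · intro σ _ hσ
    have hex : ∃ i ∈ sᶜ, σ i ≠ i := by
      by_contra! hfix
      have hm : ∀ x, σ x ∈ s ↔ x ∈ s := by
        intro x
        by_cases hx : x ∈ s
        · simp only [hx, iff_true]
          by_contra h
          have h2 := hfix _ (Finset.mem_compl.2 h)
          exact h (by rwa [σ.injective h2])
        · rw [hfix x (Finset.mem_compl.2 hx)]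
      exact hσ ⟨σ.subtypePerm hm, by simp, Equiv.Perm.ofSubtype_subtypePerm hm fun x hx => by
        by_contra h; exact hx (hfix x (Finset.mem_compl.2 h))⟩
    obtain ⟨i, hi, hne⟩ := hex
    rw [Finset.prod_eq_zero hi (if_neg hne), zero_mul, zero_smul, smul_zero]
  · intro σ _
    rw [Equiv.Perm.sign_ofSubtype, smul_comm]
    congr 2
    · congr 1
      refine Finset.prod_congr rfl fun i hi => ?_
      rw [if_pos (Equiv.Perm.ofSubtype_apply_of_not_mem σ (Finset.mem_compl.1 hi))]
    · simp

variable {R : Type*} [Ring R] [Algebra ℂ R]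

/-- Twisting by commuting quantum tori turns a `q`-determinant into an ordinary one. -/
theorem qDet_one_twist {q : ℂ} {u v : ι → S} (hu : ∀ i j, i < j → u j * u i = q⁻¹ • (u i * u j))
    (huv : ∀ i j, v i * u j = u j * v i) (ρ : R →ₐ[ℂ] S) (hρu : ∀ r i, u i * ρ r = ρ r * u i)
    (hρv : ∀ r i, v i * ρ r = ρ r * v i) (M : Matrix ι ι R) :
    qDet 1 (Matrix.of fun k l => ρ (M k l) * (u k * v l)) =
      ρ (qDet q M) * (orderedProd u * orderedProd v) := by
  simp only [qDet_eq, Matrix.of_apply, map_sum, map_smul, Finset.sum_mul]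
  refine Finset.sum_congr rfl fun σ _ => ?_
  -- The `v`'s are already in order; sorting the `u`'s yields `q^{-inv σ}`, which turns the weight
  -- `(-1)^{inv σ}` into `(-q)^{-inv σ}`.
  rw [orderedProd_mul (f := fun j => ρ (M (σ j) j)) (g := fun j => u (σ j) * v j)
    (fun i j => by rw [mul_assoc, hρv, ← mul_assoc, hρu, mul_assoc]),
    orderedProd_mul (f := fun j => u (σ j)) (g := v) (fun i j => huv _ _),
    orderedProd_perm hu, map_orderedProd, smul_mul_assoc, smul_mul_assoc, mul_smul_comm, smul_smul,
    ← mul_pow, ← mul_inv, neg_mul, one_mul]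

/-- No relation among the entries of `M` enters, so this applies to the Sylvester matrix as well as
to `A`. -/
theorem qDet_one_diagonal_sub_twist {q : ℂ} {u v : ι → S}
    (hu : ∀ i j, i < j → u j * u i = q⁻¹ • (u i * u j))
    (huv : ∀ i j, v i * u j = u j * v i) (ρ : R →ₐ[ℂ] S) (hρu : ∀ r i, u i * ρ r = ρ r * u i)
    (hρv : ∀ r i, v i * ρ r = ρ r * v i) (ε : ι → ℂ) (M : Matrix ι ι R) :
    qDet 1 (Matrix.diagonal (fun i => ε i • (1 : S)) -
        Matrix.of fun k l => ρ (M k l) * (u k * v l)) =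
      ∑ J : Finset ι, ((∏ i ∈ Jᶜ, ε i) * (-1) ^ J.card) •
        (ρ (qDet q (M.submatrix (fun i : J => (i : ι)) (fun j : J => (j : ι)))) *
          ((orderedProd fun i : J => u i) * orderedProd fun i : J => v i)) := by
  rw [qDet_one_diagonal_sub, qDetDiagSub]
  refine Finset.sum_congr rfl fun J _ => ?_
  exact congrArg _ (qDet_one_twist (fun (i j : J) hij => hu i j hij) (fun i j => huv i j) ρ
    (fun r i => hρu r i) (fun r i => hρv r i) (M.submatrix (fun i : J => (i : ι)) fun j => (j : ι)))

end Expansion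

open scoped TensorProduct

/-! ### Manin matrices, Grassmann variables and the Schur complement. -/

section Schur

variable {ι : Type*} [LinearOrder ι] [Fintype ι] {S : Type*} [Ring S] [Algebra ℂ S]

/-- Elements of the exterior algebra over `S` generated by the `e_i`, as abstract data: an algebra
`T` over `S` with anticommuting elements `ψ i` such that the coefficient of `∏ ψ i` is
well defined. -/
theorem exists_grassmann.{u, w} (ι : Type u) [LinearOrder ι] [Fintype ι] (S : Type w) [Ring S]
    [Algebra ℂ S] : ∃ (T : Type (max u w)) (_ : Ring T) (_ : Algebra ℂ T) (ρ : S →ₐ[ℂ] T) (ψ : ι → T),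
      (∀ i j, ψ j * ψ i = -(ψ i * ψ j)) ∧ (∀ i, ψ i * ψ i = 0) ∧
      (∀ s i, ψ i * ρ s = ρ s * ψ i) ∧
      ∀ s, ρ s * orderedProd ψ = 0 → s = 0 := by
  classical
  let E := ExteriorAlgebra ℂ (ι → ℂ)
  let b : ι → E := fun i => ExteriorAlgebra.ι ℂ (Pi.single i 1)
  refine ⟨TensorProduct ℂ S E, inferInstance, inferInstance,
    Algebra.TensorProduct.includeLeft, fun i => (1 : S) ⊗ₜ[ℂ] b i, ?_, ?_, ?_, ?_⟩
  · intro i j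
    simp only [Algebra.TensorProduct.tmul_mul_tmul, mul_one, ← TensorProduct.tmul_neg]
    congr 1
    exact eq_neg_of_add_eq_zero_left (ExteriorAlgebra.ι_add_mul_swap _ _)
  · intro i
    simp [b, Algebra.TensorProduct.tmul_mul_tmul, E]
  · intro s i
    simp [Algebra.TensorProduct.tmul_mul_tmul]
  · intro s hs
    let n := Fintype.card ι
    let e : Fin n ≃o ι := Fintype.orderIsoFinOfCardEq ι rfl
    have hprod : orderedProd (fun i => (1 : S) ⊗ₜ[ℂ] b i) = (1 : S) ⊗ₜ[ℂ]
        ExteriorAlgebra.ιMulti ℂ n (fun k => (Pi.single (e k) (1 : ℂ) : ι → ℂ)) := by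
      rw [← orderedProd_orderIso e, ExteriorAlgebra.ιMulti_apply, orderedProd, Fin.sort_univ,
        List.ofFn_eq_map]
      induction List.finRange n with
      | nil => rfl
      | cons a l ih => simp only [List.map_cons, List.prod_cons, ih,
          Algebra.TensorProduct.tmul_mul_tmul, mul_one]; rfl
    -- The functional reading off the top coefficient: the determinant in degree `n`, zero in all
    -- other degrees.
    let f : ∀ k : ℕ, (ι → ℂ) [⋀^Fin k]→ₗ[ℂ] ℂ := fun k =>
      if h : k = n then
        (((Pi.basisFun ℂ ι).det).domDomCongr (e.symm.toEquiv.trans (finCongr h.symm)))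
      else 0
    let φ : TensorProduct ℂ S E →ₗ[ℂ] S :=
      (TensorProduct.rid ℂ S).toLinearMap ∘ₗ (ExteriorAlgebra.liftAlternating f).lTensor S
    have h2 := congrArg φ hs
    rw [hprod] at h2
    have h3 : f n (fun k => (Pi.single (e k) (1 : ℂ) : ι → ℂ)) = 1 := by
      simp only [f, dif_pos rfl]
      rw [AlternatingMap.domDomCongr_apply]
      convert (Pi.basisFun ℂ ι).det_self using 2
      funext i
      simp
    simpa [φ, Algebra.TensorProduct.tmul_mul_tmul, ExteriorAlgebra.liftAlternating_apply_ιMulti,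
      h3] using h2

/-- The column relations of a Manin matrix. -/
def IsManin {κ κ' : Type*} (X : Matrix κ κ' S) : Prop :=
  ∀ i j k l, X i k * X j l + X i l * X j k = X j k * X i l + X j l * X i k

theorem IsManin.submatrix {S κ κ' μ μ' : Type*} [Ring S] {X : Matrix μ μ' S} (hX : IsManin X)
    (p : κ → μ) (r : κ' → μ') : IsManin (X.submatrix p r) :=
  fun i j k l => hX (p i) (p j) (r k) (r l)

/-- Exchanging the two summation indices and using the Manin relation shows that the anticommutator
`Z` equals `-Z`. -/
theorem linearForms_anticomm {κ : Type*} [Fintype κ] {T : Type*} [Ring T] [Algebra ℂ T]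
    {ρ : S →ₐ[ℂ] T} {ψ : κ → T} (hψ : ∀ i j, ψ j * ψ i = -(ψ i * ψ j))
    (hρ : ∀ s i, ψ i * ρ s = ρ s * ψ i) {κ' : Type*} {X : Matrix κ κ' S} (hX : IsManin X)
    (k l : κ') :
    (∑ i, ρ (X i l) * ψ i) * (∑ i, ρ (X i k) * ψ i) =
      -((∑ i, ρ (X i k) * ψ i) * ∑ i, ρ (X i l) * ψ i) := by
  have hmul : ∀ k l, (∑ i, ρ (X i k) * ψ i) * (∑ i, ρ (X i l) * ψ i) =
      ∑ i, ∑ j, ρ (X i k * X j l) * (ψ i * ψ j) := by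
    intro k l
    rw [Finset.sum_mul_sum]
    refine Finset.sum_congr rfl fun i _ => Finset.sum_congr rfl fun j _ => ?_
    rw [map_mul, mul_assoc, ← mul_assoc (ψ i), hρ, mul_assoc, mul_assoc]
  rw [eq_neg_iff_add_eq_zero, hmul, hmul, ← Finset.sum_add_distrib]
  simp only [← Finset.sum_add_distrib, ← add_mul, ← map_add]
  set Z := ∑ i, ∑ j, ρ (X i l * X j k + X i k * X j l) * (ψ i * ψ j) with hZ
  have hneg : Z = -Z := by
    conv_lhs => rw [hZ, Finset.sum_comm]
    rw [hZ, ← Finset.sum_neg_distrib]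
    refine Finset.sum_congr rfl fun i _ => ?_
    rw [← Finset.sum_neg_distrib]
    refine Finset.sum_congr rfl fun j _ => ?_
    rw [hψ i j, mul_neg, add_comm (X j l * X i k), ← hX i j k l, add_comm (X i k * X j l)]
  have h2 : (2 : ℂ) • Z = 0 := by
    rw [two_smul]
    nth_rewrite 1 [hneg]
    exact neg_add_cancel Z
  exact (smul_eq_zero_iff_right two_ne_zero).1 h2

theorem square_zero_of_anticomm {T : Type*} [Ring T] [Algebra ℂ T] {x : T}
    (h : x * x = -(x * x)) : x * x = 0 := by
  have h2 : (2 : ℂ) • (x * x) = 0 := by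
    rw [two_smul]
    nth_rewrite 1 [h]
    exact neg_add_cancel _
  exact (smul_eq_zero_iff_right two_ne_zero).1 h2

variable {κ₀ κ₁ : Type*} [LinearOrder κ₀] [LinearOrder κ₁] [Fintype κ₀] [Fintype κ₁]
  {e₀ : κ₀ → ι} {e₁ : κ₁ → ι}

theorem orderedProd_split {T : Type*} [Ring T] (h₀ : StrictMono e₀) (h₁ : StrictMono e₁)
    (h₀₁ : ∀ a b, e₀ a < e₁ b) (hcov : ∀ i, (∃ a, e₀ a = i) ∨ ∃ b, e₁ b = i) (f : ι → T) :
    orderedProd f = (orderedProd fun a => f (e₀ a)) * orderedProd fun b => f (e₁ b) := by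
  have hs : (Finset.univ : Finset ι).sort =
      (Finset.univ : Finset κ₀).sort.map e₀ ++ (Finset.univ : Finset κ₁).sort.map e₁ := by
    refine sort_univ_eq (List.pairwise_append.2 ⟨?_, ?_, ?_⟩) ?_
    · exact List.Pairwise.map _ (fun _ _ h => h₀ h) (Finset.sortedLT_sort _).pairwise
    · exact List.Pairwise.map _ (fun _ _ h => h₁ h) (Finset.sortedLT_sort _).pairwise
    · intro x hx y hy
      obtain ⟨a, -, rfl⟩ := List.mem_map.1 hx
      obtain ⟨b, -, rfl⟩ := List.mem_map.1 hy
      exact h₀₁ a b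
    · intro i
      simpa using hcov i
  simp only [orderedProd, hs, List.map_append, List.prod_append, List.map_map, Function.comp_def]

theorem sum_split {T : Type*} [AddCommMonoid T] (h₀ : StrictMono e₀) (h₁ : StrictMono e₁)
    (h₀₁ : ∀ a b, e₀ a < e₁ b) (hcov : ∀ i, (∃ a, e₀ a = i) ∨ ∃ b, e₁ b = i) (f : ι → T) :
    ∑ i, f i = ∑ a, f (e₀ a) + ∑ b, f (e₁ b) := by
  have hb : Function.Bijective (Sum.elim e₀ e₁) := by
    refine ⟨h₀.injective.sumElim h₁.injective fun a b => (h₀₁ a b).ne, fun i => ?_⟩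
    rcases hcov i with ⟨a, ha⟩ | ⟨b, hb⟩
    · exact ⟨Sum.inl a, ha⟩
    · exact ⟨Sum.inr b, hb⟩
  rw [← (Equiv.ofBijective _ hb).sum_comp, Fintype.sum_sum_type]
  rfl

/-- The determinant of a Manin matrix is the determinant of a block times that of its Schur
complement. -/
theorem qDet_one_schur (h₀ : StrictMono e₀) (h₁ : StrictMono e₁)
    (h₀₁ : ∀ a b, e₀ a < e₁ b) (hcov : ∀ i, (∃ a, e₀ a = i) ∨ ∃ b, e₁ b = i)
    {X : Matrix ι ι S} (hX : IsManin X) {G : Matrix κ₀ κ₀ S} (hG : X.submatrix e₀ e₀ * G = 1) :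
    qDet 1 X = qDet 1 (X.submatrix e₀ e₀) *
      qDet 1 (X.submatrix e₁ e₁ - X.submatrix e₁ e₀ * (G * X.submatrix e₀ e₁)) := by
  obtain ⟨T, _, _, ρ, ψ, hψ, hψ2, hρ, hinj⟩ := exists_grassmann ι S
  set r := G * X.submatrix e₀ e₁ with hr
  set Y := X.submatrix e₁ e₁ - X.submatrix e₁ e₀ * r with hY
  -- Only this equation is used, so a right inverse `G` suffices.
  have hXr : X.submatrix e₀ e₀ * r = X.submatrix e₀ e₁ := by
    rw [hr, ← Matrix.mul_assoc, hG, Matrix.one_mul]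
  let η : ι → T := fun j => ∑ i, ρ (X i j) * ψ i
  let η₀ : κ₀ → T := fun a => ∑ i, ρ (X (e₀ i) (e₀ a)) * ψ (e₀ i)
  let θ : κ₁ → T := fun b => ∑ i, ρ (Y i b) * ψ (e₁ i)
  have hη : ∀ k l, η l * η k = -(η k * η l) := fun k l => linearForms_anticomm hψ hρ hX k l
  have hη2 : ∀ k, η k * η k = 0 := fun k => square_zero_of_anticomm (hη k k)
  -- The column operation: modulo right multiples of the first columns, a last column becomes a
  -- column of the Schur complement, which involves only the variables `ψ (e₁ i)`.
  have hA : ∀ b, η (e₁ b) = θ b + ∑ a, η (e₀ a) * ρ (r a b) := by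
    intro b
    have hsum : ∑ a, η (e₀ a) * ρ (r a b) = ∑ i, ρ (∑ a, X i (e₀ a) * r a b) * ψ i := by
      simp only [η, Finset.sum_mul, map_sum, map_mul]
      rw [Finset.sum_comm]
      refine Finset.sum_congr rfl fun i _ => Finset.sum_congr rfl fun a _ => ?_
      rw [mul_assoc, hρ, mul_assoc]
    rw [hsum, sum_split h₀ h₁ h₀₁ hcov, show η (e₁ b) = ∑ i, ρ (X i (e₁ b)) * ψ i from rfl,
      sum_split h₀ h₁ h₀₁ hcov, add_left_comm, ← Finset.sum_add_distrib]
    congr 1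
    · refine Finset.sum_congr rfl fun a _ => ?_
      rw [← Matrix.submatrix_apply X e₀ e₁, ← hXr]
      rfl
    · refine Finset.sum_congr rfl fun i _ => ?_
      rw [← add_mul, ← map_add]
      congr 2
      exact (sub_add_cancel _ _).symm
  -- Once `P` kills all `η (e₀ a)` from the left, each `η (e₁ b)` can be replaced by `θ b`; the
  -- hypothesis survives for `P * η (e₁ b)` by anticommutation of the `η`'s alone.
  have hB : ∀ (L : List κ₁) (P : T), (∀ a, P * η (e₀ a) = 0) →
      P * (L.map fun b => η (e₁ b)).prod = P * (L.map θ).prod := by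
    intro L
    induction L with
    | nil => intro P _; rfl
    | cons b l ih =>
      intro P hP
      have h1 : P * η (e₁ b) = P * θ b := by
        rw [hA, mul_add, add_eq_left, Finset.mul_sum]
        refine Finset.sum_eq_zero fun a _ => ?_
        rw [← mul_assoc, hP, zero_mul]
      simp only [List.map_cons, List.prod_cons]
      rw [← mul_assoc, ih, h1, mul_assoc]
      intro a
      rw [mul_assoc, hη, mul_neg, ← mul_assoc, hP, zero_mul, neg_zero]
  have hC : ∀ a, (orderedProd fun a => η (e₀ a)) * η (e₀ a) = 0 := by
    intro a
    have h := prod_map_eq_zero_of_not_nodup (y := fun a => η (e₀ a)) (fun i j => hη _ _)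
      (fun i => hη2 _) ((Finset.univ : Finset κ₀).sort ++ [a])
      (by rw [List.nodup_append]; simp)
    rwa [List.map_append, List.prod_append, List.map_singleton, List.prod_singleton] at h
  -- Dually, `z` will contain all `ψ (e₁ b)`, so the parts of the first columns along these
  -- variables drop out, leaving the forms `η₀` of the upper left block.
  have hD : ∀ z : T, (∀ b, ψ (e₁ b) * z = 0) → ∀ L : List κ₀,
      (L.map fun a => η (e₀ a)).prod * z = (L.map η₀).prod * z ∧
        ∀ b, ψ (e₁ b) * ((L.map η₀).prod * z) = 0 := by
    intro z hz L
    induction L with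
    | nil => exact ⟨rfl, fun b => by simpa using hz b⟩
    | cons a l ih =>
      simp only [List.map_cons, List.prod_cons, mul_assoc]
      refine ⟨?_, fun b => ?_⟩
      · rw [ih.1, show η (e₀ a) = ∑ i, ρ (X i (e₀ a)) * ψ i from rfl,
          sum_split h₀ h₁ h₀₁ hcov, add_mul, add_eq_left, Finset.sum_mul]
        refine Finset.sum_eq_zero fun b _ => ?_
        rw [mul_assoc, ih.2, mul_zero]
      · rw [← mul_assoc, Finset.mul_sum, Finset.sum_mul]
        refine Finset.sum_eq_zero fun i _ => ?_
        rw [← mul_assoc (ψ _), hρ, mul_assoc (ρ _), hψ, mul_assoc, neg_mul, mul_assoc, ih.2,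
          mul_zero, neg_zero, mul_zero]
  have hρ₀ : ∀ s, (orderedProd fun a => ψ (e₀ a)) * ρ s = ρ s * orderedProd fun a => ψ (e₀ a) := by
    intro s
    rw [orderedProd]
    induction (Finset.univ : Finset κ₀).sort with
    | nil => simp
    | cons a l ih => rw [List.map_cons, List.prod_cons, mul_assoc, ih, ← mul_assoc, hρ, mul_assoc]
  have hz : ∀ b, ψ (e₁ b) * (ρ (qDet 1 Y) * orderedProd fun b => ψ (e₁ b)) = 0 := by
    intro b
    have h := prod_map_eq_zero_of_not_nodup (y := fun b => ψ (e₁ b)) (fun i j => hψ _ _)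
      (fun i => hψ2 _) (b :: (Finset.univ : Finset κ₁).sort) (by simp)
    rw [List.map_cons, List.prod_cons] at h
    rw [← mul_assoc, hρ, mul_assoc, orderedProd, h, mul_zero]
  have key : ρ (qDet 1 X) * orderedProd ψ =
      ρ (qDet 1 (X.submatrix e₀ e₀) * qDet 1 Y) * orderedProd ψ := by
    rw [← orderedProd_linearForms hψ hψ2 ρ hρ X, orderedProd_split h₀ h₁ h₀₁ hcov]
    have e1 : (orderedProd fun a => η (e₀ a)) * (orderedProd fun b => η (e₁ b)) =
        (orderedProd fun a => η (e₀ a)) * orderedProd θ := hB _ _ hC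
    have e2 : orderedProd θ = ρ (qDet 1 Y) * orderedProd fun b => ψ (e₁ b) :=
      orderedProd_linearForms (fun i j => hψ _ _) (fun i => hψ2 _) ρ (fun s i => hρ s _) Y
    have e3 : orderedProd η₀ =
        ρ (qDet 1 (X.submatrix e₀ e₀)) * orderedProd fun a => ψ (e₀ a) :=
      orderedProd_linearForms (fun i j => hψ _ _) (fun i => hψ2 _) ρ (fun s i => hρ s _)
        (X.submatrix e₀ e₀)
    refine e1.trans ?_
    rw [e2]
    refine ((hD _ hz _).1).trans ?_
    change orderedProd η₀ * _ = _
    rw [e3, orderedProd_split h₀ h₁ h₀₁ hcov ψ, mul_assoc, ← mul_assoc (orderedProd _), hρ₀,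
      map_mul]
    simp only [mul_assoc]
  rw [← sub_eq_zero] at key ⊢
  exact hinj _ (by rw [map_sub, sub_mul]; exact key)

end Schur

/-! ### Inverses of noncommutative power series and of matrices of them. -/

namespace NCPowerSeries

section

variable {X K : Type*} [Ring K]

/-- The coefficients of the right inverse of a series with constant coefficient `1`. -/
def rightInvCoeff (f : NCPowerSeries X K) : List X → K
  | [] => 1
  | a :: w => -∑ k ∈ Finset.range (w.length + 1),
      f.coeff (a :: w.take k) * rightInvCoeff f (w.drop k)
termination_by w => w.length
decreasing_by simp

theorem mul_rightInv {f : NCPowerSeries X K} (hf : f.coeff [] = 1) :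
    f * ⟨rightInvCoeff f⟩ = 1 := by
  ext w
  cases w with
  | nil => simp [coeff_mul, hf, coeff_one_nil, rightInvCoeff]
  | cons a w =>
    rw [coeff_mul, coeff_one_of_ne_nil (List.cons_ne_nil _ _), Finset.sum_range_succ']
    simp only [List.take_zero, List.drop_zero, hf, one_mul, List.take_succ_cons,
      List.drop_succ_cons, List.length_cons]
    rw [rightInvCoeff, add_neg_cancel]

/-- The right inverse again has constant coefficient `1`, hence a right inverse of its own, which
must be `f`. -/
theorem isUnit_of_coeff_nil_eq_one {f : NCPowerSeries X K} (hf : f.coeff [] = 1) : IsUnit f := by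
  have h1 := mul_rightInv hf
  have h2 := mul_rightInv (f := ⟨rightInvCoeff f⟩) (by simp [rightInvCoeff])
  refine ⟨⟨f, ⟨rightInvCoeff f⟩, h1, ?_⟩, rfl⟩
  rwa [← left_inv_eq_right_inv h1 h2] at h2

theorem coeff_sum {α : Type*} (s : Finset α) (F : α → NCPowerSeries X K) (w : List X) :
    (∑ i ∈ s, F i).coeff w = ∑ i ∈ s, (F i).coeff w := by
  classical
  induction s using Finset.induction_on with
  | empty => simp [coeff_zero]
  | insert a s ha ih => rw [Finset.sum_insert ha, Finset.sum_insert ha, coeff_add, ih]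

/-- A matrix of series is a series with matrix coefficients; here its constant coefficient is the
identity matrix. -/
theorem exists_matrix_right_inverse {n : Type*} [Fintype n] [DecidableEq n]
    (N : Matrix n n (NCPowerSeries X K)) (hN : ∀ i j, (N i j).coeff [] = 0) :
    ∃ G, (1 - N) * G = 1 := by
  let f : NCPowerSeries X (Matrix n n K) := ⟨fun w => Matrix.of fun i j => ((1 - N) i j).coeff w⟩
  have hone : ∀ w i j, ((1 : Matrix n n (NCPowerSeries X K)) i j).coeff w =
      (1 : NCPowerSeries X (Matrix n n K)).coeff w i j := by
    intro w i j
    by_cases hw : w = []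
    · subst hw
      by_cases hij : i = j
      · subst hij; rw [Matrix.one_apply_eq, coeff_one_nil, coeff_one_nil, Matrix.one_apply_eq]
      · simp [hij, coeff_one_nil, coeff_zero]
    · by_cases hij : i = j
      · subst hij; rw [Matrix.one_apply_eq, coeff_one_of_ne_nil hw, coeff_one_of_ne_nil hw,
          Matrix.zero_apply]
      · simp [hij, coeff_one_of_ne_nil hw, coeff_zero]
  have hf : f.coeff [] = 1 := by
    ext i j
    change ((1 - N) i j).coeff [] = _
    rw [Matrix.sub_apply, sub_eq_add_neg, coeff_add, coeff_neg, hN, neg_zero, add_zero, hone,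
      coeff_one_nil]
  have h := mul_rightInv hf
  refine ⟨Matrix.of fun i j => ⟨fun w => rightInvCoeff f w i j⟩, ?_⟩
  ext i j w
  rw [hone, ← h, Matrix.mul_apply, coeff_sum, coeff_mul, Matrix.sum_apply]
  simp only [coeff_mul, Matrix.mul_apply]
  rw [Finset.sum_comm]
  rfl

end

section

variable {X K : Type*} [CommRing K]

/-- The constant coefficient, as an algebra homomorphism. -/
def constCoeff : NCPowerSeries X K →ₐ[K] K where
  toFun f := f.coeff []
  map_one' := rfl
  map_mul' f g := by simp [coeff_mul]
  map_zero' := rfl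
  map_add' _ _ := rfl
  commutes' r := by
    rw [Algebra.algebraMap_eq_smul_one, coeff_smul, coeff_one_nil, mul_one]; rfl

theorem constCoeff_apply (f : NCPowerSeries X K) : constCoeff f = f.coeff [] := rfl

theorem coeff_var_nil (x : X) : (var x : NCPowerSeries X K).coeff [] = 0 := by
  simp [var]

end

end NCPowerSeries

theorem qDet_zero {ι R : Type*} [LinearOrder ι] [Fintype ι] [Nonempty ι] [Ring R] [Algebra ℂ R]
    (q : ℂ) : qDet q (0 : Matrix ι ι R) = 0 := by
  rw [qDet_eq]
  refine Finset.sum_eq_zero fun σ _ => ?_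
  have h : (orderedProd fun j => (0 : Matrix ι ι R) (σ j) j) = 0 := by
    obtain ⟨i⟩ := ‹Nonempty ι›
    exact List.prod_eq_zero (List.mem_map.2 ⟨i, by simp, rfl⟩)
  rw [h, smul_zero]

theorem qDet_of_isEmpty {ι R : Type*} [LinearOrder ι] [Fintype ι] [IsEmpty ι] [Ring R]
    [Algebra ℂ R] (q : ℂ) (M : Matrix ι ι R) : qDet q M = 1 := by
  simp [qDet, invCount]

/-! ### Invertibility over the quotient, lifted to power series. -/

section VarMatrix

variable {m : ℕ} (I : TwoSidedIdeal (SeriesAlg m))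

/-- A combination of principal `q`-minors of a matrix of variables is a unit if the coefficient
of the empty minor is `1`. -/
theorem isUnit_sum_minors (q : ℂ) {κ : Type*} [LinearOrder κ] [Fintype κ] (e : κ → Fin m)
    (c : Finset κ → ℂ) (hc : c ∅ = 1) :
    IsUnit (∑ J : Finset κ, c J • qDet q (((varMatrix I).submatrix e e).submatrix
      (fun i : J => (i : κ)) (fun j : J => (j : κ)))) := by
  let V : Matrix κ κ (SeriesAlg m) := Matrix.of fun i j => NCPowerSeries.var (e i, e j)
  have h1 : (∑ J : Finset κ, c J • qDet q (((varMatrix I).submatrix e e).submatrix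
      (fun i : J => (i : κ)) (fun j : J => (j : κ)))) =
      I.ringCon.mkₐ ℂ (∑ J : Finset κ, c J • qDet q (V.submatrix
        (fun i : J => (i : κ)) (fun j : J => (j : κ)))) := by
    simp only [map_sum, map_smul, map_qDet]
    rfl
  rw [h1]
  refine IsUnit.map _ (NCPowerSeries.isUnit_of_coeff_nil_eq_one ?_)
  rw [← NCPowerSeries.constCoeff_apply]
  simp only [map_sum, map_smul, map_qDet]
  rw [Finset.sum_eq_single ∅]
  · rw [hc, qDet_of_isEmpty, one_smul]
  · intro J _ hJ
    have : Nonempty J := (Finset.nonempty_iff_ne_empty.2 hJ).to_subtype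
    have hz : ((V.submatrix (fun i : J => (i : κ)) (fun j : J => (j : κ))).map
        (NCPowerSeries.constCoeff : SeriesAlg m →ₐ[ℂ] ℂ)) = 0 := by
      ext i j
      exact NCPowerSeries.coeff_var_nil (e i, e j)
    rw [hz, qDet_zero, smul_zero]
  · simp

/-- The scalars `c` stand for the powers of `q` that the twist produces at a fixed point of `ℤ^m`.
-/
theorem exists_right_inverse_one_sub (c : Fin m → Fin m → ℂ) {κ : Type*} [Fintype κ]
    [DecidableEq κ] (e : κ → Fin m) :
    ∃ G, (1 - Matrix.of fun i j => c (e i) (e j) • varMatrix I (e i) (e j) :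
      Matrix κ κ I.ringCon.Quotient) * G = 1 := by
  obtain ⟨G, hG⟩ := NCPowerSeries.exists_matrix_right_inverse
    (Matrix.of fun i j => c (e i) (e j) • (NCPowerSeries.var (e i, e j) : SeriesAlg m) :
      Matrix κ κ (SeriesAlg m)) (by
        intro i j
        simp [NCPowerSeries.coeff_smul, NCPowerSeries.coeff_var_nil])
  refine ⟨G.map (I.ringCon.mkₐ ℂ), ?_⟩
  have h := congrArg (fun M => M.map (I.ringCon.mkₐ ℂ)) hG
  simp only [Matrix.map_mul] at h
  rw [Matrix.map_one _ (map_zero _) (map_one _)] at h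
  have h2 : (1 - Matrix.of fun i j => c (e i) (e j) • (NCPowerSeries.var (e i, e j) : SeriesAlg m) :
      Matrix κ κ (SeriesAlg m)).map (I.ringCon.mkₐ ℂ) =
      1 - Matrix.of fun i j => c (e i) (e j) • varMatrix I (e i) (e j) := by
    ext i j
    by_cases hij : i = j
    · subst hij
      simp only [Matrix.sub_apply, Matrix.map_apply, Matrix.of_apply, map_sub, map_smul,
        Matrix.one_apply_eq, map_one]
      rfl
    · simp only [Matrix.sub_apply, Matrix.map_apply, Matrix.of_apply, map_sub, map_smul,
        Matrix.one_apply_ne hij, map_zero]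
      rfl
  rw [← h2, h]

end VarMatrix

/-! ### Manin matrices from `q`-right-quantum ones. -/

section Manin

variable {S : Type*} [Ring S] [Algebra ℂ S] {ι : Type*} [LinearOrder ι]

/-- The Manin relation says `[X_{ik}, X_{jl}] + [X_{il}, X_{jk}] = 0`, and subtracting `B` from
central scalars leaves commutators unchanged. -/
theorem IsManin.diagonal_sub {B : Matrix ι ι S} (hB : IsManin B) (ε : ι → ℂ) :
    IsManin (Matrix.diagonal (fun i => ε i • (1 : S)) - B) := by
  have hd : ∀ i j, ∃ c : ℂ, Matrix.diagonal (fun i => ε i • (1 : S)) i j = c • 1 := fun i j => by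
    by_cases h : i = j
    · exact ⟨ε i, by rw [h, Matrix.diagonal_apply_eq]⟩
    · exact ⟨0, by rw [Matrix.diagonal_apply_ne _ h, zero_smul]⟩
  intro i j k l
  have h := hB i j k l
  obtain ⟨c₁, h₁⟩ := hd i k
  obtain ⟨c₂, h₂⟩ := hd j l
  obtain ⟨c₃, h₃⟩ := hd i l
  obtain ⟨c₄, h₄⟩ := hd j k
  simp only [Matrix.sub_apply, h₁, h₂, h₃, h₄, sub_mul, mul_sub, smul_mul_assoc, mul_smul_comm,
    one_mul, mul_one, smul_sub, smul_comm c₂ c₁, smul_comm c₃ c₄]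
  rw [← sub_eq_zero] at h ⊢
  rw [← h]
  abel

variable {R : Type*} [Ring R] [Algebra ℂ R]

theorem isManin_twist {q : ℂ} (hq : q ≠ 0) {A : Matrix ι ι R} (hA : IsQRightQuantum q A)
    {u v : ι → S} (hu : ∀ i j, i < j → u j * u i = q⁻¹ • (u i * u j))
    (hv : ∀ i j, i < j → v j * v i = q • (v i * v j))
    (huv : ∀ i j, v i * u j = u j * v i) (ρ : R →ₐ[ℂ] S) (hρu : ∀ r i, u i * ρ r = ρ r * u i)
    (hρv : ∀ r i, v i * ρ r = ρ r * v i) :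
    IsManin (Matrix.of fun k l => ρ (A k l) * (u k * v l)) := by
  have hmul : ∀ i k j l, ρ (A i k) * (u i * v k) * (ρ (A j l) * (u j * v l)) =
      ρ (A i k * A j l) * (u i * u j * (v k * v l)) := by
    intro i k j l
    simp only [map_mul, mul_assoc]
    rw [← mul_assoc (v k) (ρ _), hρv, mul_assoc, ← mul_assoc (u i) (ρ _), hρu, mul_assoc,
      ← mul_assoc (v k) (u j), huv, mul_assoc]
  -- After sorting, each `u_j u_i` contributes `q⁻¹` and each `v_l v_k` contributes `q`; what
  -- remains is the first right-quantum relation if `k = l` and the second if `k < l`.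
  have hmain : ∀ i j k l, i < j → k ≤ l →
      ρ (A i k * A j l) * (u i * u j * (v k * v l)) + ρ (A i l * A j k) * (u i * u j * (v l * v k)) =
      ρ (A j k * A i l) * (u j * u i * (v k * v l)) +
        ρ (A j l * A i k) * (u j * u i * (v l * v k)) := by
    intro i j k l hij hkl
    rcases hkl.eq_or_lt with rfl | hkl
    · have h : ρ (A j k * A i k) * (u j * u i * (v k * v k)) =
          ρ (A i k * A j k) * (u i * u j * (v k * v k)) := by
        rw [hA.1 i j k hij, hu i j hij, map_smul, smul_mul_assoc, smul_mul_assoc, mul_smul_comm,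
          smul_smul, mul_inv_cancel₀ hq, one_smul]
      rw [h]
    · have h := congrArg (fun x => ρ x * (u i * u j * (v k * v l))) (hA.2 i j k l hij hkl)
      simp only [map_sub, map_smul, sub_mul, smul_mul_assoc] at h
      rw [hu i j hij, hv k l hkl]
      simp only [smul_mul_assoc, mul_smul_comm, smul_smul, mul_inv_cancel₀ hq, one_smul]
      rw [sub_eq_sub_iff_add_eq_add] at h
      rw [h, add_comm]
  have hlt : ∀ i j k l, i < j →
      ρ (A i k * A j l) * (u i * u j * (v k * v l)) + ρ (A i l * A j k) * (u i * u j * (v l * v k)) =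
      ρ (A j k * A i l) * (u j * u i * (v k * v l)) +
        ρ (A j l * A i k) * (u j * u i * (v l * v k)) := by
    intro i j k l hij
    rcases le_total k l with h | h
    · exact hmain i j k l hij h
    · rw [add_comm, hmain i j l k hij h, add_comm]
  intro i j k l
  simp only [Matrix.of_apply, hmul]
  rcases lt_trichotomy i j with h | rfl | h
  · exact hlt i j k l h
  · rfl
  · exact (hlt j i k l h).symm

end Manin

/-! ### The twisting operators on functions on `ℤ^m`. -/

section TwistOperators

variable {m : ℕ} (q : ℂ) (R : Type*) [Ring R] [Algebra ℂ R]

/-- The raising operator `u_i`. -/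
noncomputable def raiseOp (i : Fin m) : Module.End ℂ ((Fin m → ℤ) → R) where
  toFun f x := q ^ (∑ k ∈ Finset.Ioi i, x k) • f (x - Pi.single i 1)
  map_add' f g := by funext x; simp
  map_smul' c f := by funext x; simp [smul_comm c]

/-- The lowering operator `v_i`. -/
noncomputable def lowerOp (i : Fin m) : Module.End ℂ ((Fin m → ℤ) → R) where
  toFun f x := q ^ (-∑ k ∈ Finset.Iio i, x k) • f (x + Pi.single i 1)
  map_add' f g := by funext x; simp
  map_smul' c f := by funext x; simp [smul_comm c]

/-- Left multiplication on functions. -/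
abbrev leftMul (m : ℕ) (R : Type*) [Ring R] [Algebra ℂ R] :
    R →ₐ[ℂ] Module.End ℂ ((Fin m → ℤ) → R) :=
  Algebra.lsmul ℂ ℂ ((Fin m → ℤ) → R)

variable {q R}

theorem raiseOp_apply (i : Fin m) (f : (Fin m → ℤ) → R) (x : Fin m → ℤ) :
    raiseOp q R i f x = q ^ (∑ k ∈ Finset.Ioi i, x k) • f (x - Pi.single i 1) := rfl

theorem lowerOp_apply (i : Fin m) (f : (Fin m → ℤ) → R) (x : Fin m → ℤ) :
    lowerOp q R i f x = q ^ (-∑ k ∈ Finset.Iio i, x k) • f (x + Pi.single i 1) := rfl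

theorem leftMul_apply (r : R) (f : (Fin m → ℤ) → R) (x : Fin m → ℤ) :
    leftMul m R r f x = r * f x := rfl

theorem sum_single (s : Finset (Fin m)) (i : Fin m) :
    ∑ k ∈ s, (Pi.single i 1 : Fin m → ℤ) k = if i ∈ s then 1 else 0 := by
  simp [Pi.single_apply]

/-- Shifting by the `j`-th unit vector lowers the exponent sum over `k > i` by one, while shifting
by the `i`-th leaves the sum over `k > j` alone. -/
theorem raiseOp_mul_raiseOp (hq : q ≠ 0) (i j : Fin m) (hij : i < j) :
    raiseOp q R j * raiseOp q R i = q⁻¹ • (raiseOp q R i * raiseOp q R j) := by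
  ext f x
  simp only [Module.End.mul_apply, LinearMap.smul_apply, Pi.smul_apply, raiseOp_apply, smul_smul,
    Pi.sub_apply, Finset.sum_sub_distrib, sum_single, Finset.mem_Ioi, hij, hij.not_gt, if_true,
    if_false, sub_right_comm x (Pi.single j 1)]
  congr 1
  rw [← zpow_add₀ hq, ← zpow_add₀ hq, ← zpow_neg_one, ← zpow_add₀ hq]
  congr 1
  ring

theorem lowerOp_mul_lowerOp (hq : q ≠ 0) (i j : Fin m) (hij : i < j) :
    lowerOp q R j * lowerOp q R i = q • (lowerOp q R i * lowerOp q R j) := by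
  ext f x
  simp only [Module.End.mul_apply, LinearMap.smul_apply, Pi.smul_apply, lowerOp_apply, smul_smul,
    Pi.add_apply, Finset.sum_add_distrib, sum_single, Finset.mem_Iio, hij, hij.not_gt, if_true,
    if_false, add_right_comm x (Pi.single j 1)]
  congr 1
  nth_rewrite 3 [← zpow_one q]
  rw [← zpow_add₀ hq, ← zpow_add₀ hq, ← zpow_add₀ hq]
  congr 1
  ring

/-- In either order the shift contributes one extra factor `q` exactly when `j < i`; this is why one
exponent sums over larger indices and the other, with a minus sign, over smaller ones. -/
theorem lowerOp_mul_raiseOp (hq : q ≠ 0) (i j : Fin m) :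
    lowerOp q R i * raiseOp q R j = raiseOp q R j * lowerOp q R i := by
  ext f x
  simp only [Module.End.mul_apply, raiseOp_apply, lowerOp_apply, smul_smul,
    Pi.add_apply, Pi.sub_apply, Finset.sum_add_distrib, Finset.sum_sub_distrib, sum_single,
    Finset.mem_Iio, Finset.mem_Ioi, add_sub_right_comm x]
  congr 1
  rw [← zpow_add₀ hq, ← zpow_add₀ hq]
  congr 1
  ring

theorem raiseOp_mul_leftMul (r : R) (i : Fin m) :
    raiseOp q R i * leftMul m R r = leftMul m R r * raiseOp q R i := by
  ext f x
  simp [raiseOp_apply]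

theorem lowerOp_mul_leftMul (r : R) (i : Fin m) :
    lowerOp q R i * leftMul m R r = leftMul m R r * lowerOp q R i := by
  ext f x
  simp [lowerOp_apply]

/-- Evaluation at a point shifted by the row index makes the argument of `f` depend on the column
index only, so at fixed `x` the operator matrix becomes a matrix over `R`. -/
theorem raiseOp_lowerOp_apply (hq : q ≠ 0) (i j : Fin m) (f : (Fin m → ℤ) → R)
    (x : Fin m → ℤ) :
    raiseOp q R i (lowerOp q R j f) (x + Pi.single i 1) =
      q ^ (∑ k ∈ Finset.Ioi i, x k - ∑ k ∈ Finset.Iio j, x k) • f (x + Pi.single j 1) := by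
  simp only [raiseOp_apply, lowerOp_apply, smul_smul, Pi.add_apply,
    Finset.sum_add_distrib, sum_single, Finset.mem_Ioi, lt_irrefl, if_false, add_zero,
    add_sub_cancel_right]
  rw [← zpow_add₀ hq, sub_eq_add_neg]

theorem raiseOp_lowerOp_self_apply (hq : q ≠ 0) (i : Fin m) (f : (Fin m → ℤ) → R)
    (x : Fin m → ℤ) :
    raiseOp q R i (lowerOp q R i f) x =
      q ^ (∑ k ∈ Finset.Ioi i, x k - ∑ k ∈ Finset.Iio i, x k) • f x := by
  have h := raiseOp_lowerOp_apply hq i i f (x - Pi.single i 1)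
  simpa only [sub_add_cancel, Pi.sub_apply, Finset.sum_sub_distrib, sum_single, Finset.mem_Ioi,
    Finset.mem_Iio, lt_irrefl, if_false, sub_zero] using h

/-- The matrix `I - (a_{ij} u_i v_j)` of operators. -/
noncomputable def twistedOneSub (q : ℂ) (A : Matrix (Fin m) (Fin m) R) :
    Matrix (Fin m) (Fin m) (Module.End ℂ ((Fin m → ℤ) → R)) :=
  Matrix.diagonal (fun _ => (1 : ℂ) • 1) -
    Matrix.of fun k l => leftMul m R (A k l) * (raiseOp q R k * lowerOp q R l)

theorem isManin_twistedOneSub (hq : q ≠ 0) {A : Matrix (Fin m) (Fin m) R}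
    (hA : IsQRightQuantum q A) : IsManin (twistedOneSub q A) :=
  (isManin_twist hq hA (raiseOp_mul_raiseOp hq) (lowerOp_mul_lowerOp hq) (lowerOp_mul_raiseOp hq)
    (leftMul m R) raiseOp_mul_leftMul lowerOp_mul_leftMul).diagonal_sub _

theorem exists_right_inverse_twistedOneSub (hq : q ≠ 0) (I : TwoSidedIdeal (SeriesAlg m))
    {κ : Type*} [Fintype κ] [DecidableEq κ] {e : κ → Fin m} (he : Function.Injective e) :
    ∃ G, (twistedOneSub q (varMatrix I)).submatrix e e * G = 1 := by
  choose G hG using fun y : Fin m → ℤ => exists_right_inverse_one_sub I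
    (fun i j => q ^ (∑ k ∈ Finset.Ioi i, y k - ∑ k ∈ Finset.Iio j, y k)) e
  -- The pointwise inverses are glued: the value of `H j k f` at `y` shifted by the `j`-th unit
  -- vector uses the inverse `G y` belonging to `y`.
  let H : Matrix κ κ (Module.End ℂ ((Fin m → ℤ) → I.ringCon.Quotient)) := Matrix.of fun j k =>
    { toFun := fun f x => G (x - Pi.single (e j) 1) j k *
        f (x - Pi.single (e j) 1 + Pi.single (e k) 1)
      map_add' := fun f g => by funext x; simp [mul_add]
      map_smul' := fun c f => by funext x; simp }
  have hH : ∀ j k f y, H j k f (y + Pi.single (e j) 1) = G y j k * f (y + Pi.single (e k) 1) := by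
    intro j k f y
    change G (y + Pi.single (e j) 1 - Pi.single (e j) 1) j k *
      f (y + Pi.single (e j) 1 - Pi.single (e j) 1 + Pi.single (e k) 1) = _
    rw [add_sub_cancel_right]
  refine ⟨H, ?_⟩
  ext i k f x
  obtain ⟨y, rfl⟩ : ∃ y, x = y + Pi.single (e i) 1 := ⟨x - Pi.single (e i) 1, by simp⟩
  have h1 : ∀ j, ((twistedOneSub q (varMatrix I)).submatrix e e i j * H j k) f
      (y + Pi.single (e i) 1) =
      (1 - Matrix.of fun i j => q ^ (∑ k ∈ Finset.Ioi (e i), y k - ∑ k ∈ Finset.Iio (e j), y k) •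
        varMatrix I (e i) (e j) : Matrix κ κ I.ringCon.Quotient) i j * G y j k *
          f (y + Pi.single (e k) 1) := by
    intro j
    simp only [Matrix.submatrix_apply, twistedOneSub, Matrix.sub_apply, Matrix.of_apply, sub_mul,
      LinearMap.sub_apply, Pi.sub_apply, Module.End.mul_apply, leftMul_apply,
      raiseOp_lowerOp_apply hq, hH]
    congr 1
    · by_cases hij : i = j
      · subst hij
        simp [hH]
      · simp [hij, Matrix.diagonal_apply_ne _ (he.ne hij)]
    · rw [mul_smul_comm, smul_mul_assoc, smul_mul_assoc, mul_assoc]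
  rw [Matrix.mul_apply, LinearMap.sum_apply, Finset.sum_apply]
  simp only [h1]
  rw [← Finset.sum_mul, ← Matrix.mul_apply, hG y]
  by_cases hik : i = k
  · subst hik; simp
  · simp [hik]

end TwistOperators

/-! ### Acting on fixed functions and untwisting. -/

section Sylvester

variable {m : ℕ} {q : ℂ} {R : Type*} [Ring R] [Algebra ℂ R]

/-- The diagonal operators `u_i v_i` multiply over a product of generators. -/
theorem orderedProd_raiseOp_lowerOp_apply (hq : q ≠ 0) {κ : Type*} [LinearOrder κ] [Fintype κ]
    (e : κ → Fin m) (f : (Fin m → ℤ) → R) (x : Fin m → ℤ) :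
    ((orderedProd fun i => raiseOp q R (e i)) * orderedProd fun i => lowerOp q R (e i)) f x =
      (∏ i, q ^ (∑ k ∈ Finset.Ioi (e i), x k - ∑ k ∈ Finset.Iio (e i), x k)) • f x := by
  rw [← orderedProd_mul fun i j => lowerOp_mul_raiseOp hq _ _, orderedProd,
    ← Finset.sort_toFinset (Finset.univ : Finset κ) (· ≤ ·),
    List.prod_toFinset _ (Finset.sort_nodup _ _), Finset.sort_toFinset]
  induction (Finset.univ : Finset κ).sort with
  | nil => simp
  | cons a l ih =>
    simp only [List.map_cons, List.prod_cons, Module.End.mul_apply,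
      raiseOp_lowerOp_self_apply hq, ih, smul_smul]

/-- On an arbitrary function the diagonal operators `u_i v_i` merely weight the minors by powers of
`q` depending on `x`. This generality serves the injectivity of the upper left determinant. -/
theorem qDet_twist_apply (hq : q ≠ 0) {κ : Type*} [LinearOrder κ] [Fintype κ]
    {e : κ → Fin m} (he : StrictMono e) (ε : κ → ℂ) (M : Matrix κ κ R)
    (f : (Fin m → ℤ) → R) (x : Fin m → ℤ) :
    qDet 1 (Matrix.diagonal (fun i => ε i • (1 : Module.End ℂ ((Fin m → ℤ) → R))) -
        Matrix.of fun k l => leftMul m R (M k l) * (raiseOp q R (e k) * lowerOp q R (e l))) f x =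
      (∑ J : Finset κ, ((∏ i ∈ Jᶜ, ε i) * (-1) ^ J.card *
        ∏ i : J, q ^ (∑ k ∈ Finset.Ioi (e i), x k - ∑ k ∈ Finset.Iio (e i), x k)) •
          qDet q (M.submatrix (fun i : J => (i : κ)) (fun j : J => (j : κ)))) * f x := by
  rw [qDet_one_diagonal_sub_twist (q := q) (u := fun k => raiseOp q R (e k))
    (v := fun k => lowerOp q R (e k)) (fun i j hij => raiseOp_mul_raiseOp hq _ _ (he hij))
    (fun i j => lowerOp_mul_raiseOp hq _ _) (leftMul m R) (fun r i => raiseOp_mul_leftMul r _)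
    (fun r i => lowerOp_mul_leftMul r _), LinearMap.sum_apply, Finset.sum_apply, Finset.sum_mul]
  refine Finset.sum_congr rfl fun J _ => ?_
  rw [LinearMap.smul_apply, Pi.smul_apply, Module.End.mul_apply, leftMul_apply,
    orderedProd_raiseOp_lowerOp_apply hq (fun i : J => e i), mul_smul_comm, smul_smul,
    smul_mul_assoc]

/-- The functions fixed by the operators `u_k v_k`, `k < n`. -/
noncomputable def invariantFunctions (q : ℂ) (R : Type*) [Ring R] [Algebra ℂ R] (m n : ℕ) :
    Submodule ℂ ((Fin m → ℤ) → R) where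
  carrier := {f | ∀ k : Fin m, (k : ℕ) < n → raiseOp q R k (lowerOp q R k f) = f}
  add_mem' hf hg k hk := by rw [map_add, map_add, hf k hk, hg k hk]
  zero_mem' k _ := by rw [map_zero, map_zero]
  smul_mem' c f hf k hk := by rw [map_smul, map_smul, hf k hk]

variable {n : ℕ}

theorem leftMul_mem_invariantFunctions {f : (Fin m → ℤ) → R}
    (hf : f ∈ invariantFunctions q R m n) (r : R) :
    leftMul m R r f ∈ invariantFunctions q R m n := by
  intro k hk
  rw [← Module.End.mul_apply, ← Module.End.mul_apply, mul_assoc, lowerOp_mul_leftMul, ← mul_assoc,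
    raiseOp_mul_leftMul, mul_assoc, Module.End.mul_apply, Module.End.mul_apply, hf k hk]

/-- Since `k < i` and `k < j`, commuting `u_k v_k` past `u_i v_j` produces `q⁻¹` from the `u`'s and
`q` from the `v`'s, which cancel. -/
theorem raiseOp_lowerOp_mem_invariantFunctions (hq : q ≠ 0) {f : (Fin m → ℤ) → R}
    (hf : f ∈ invariantFunctions q R m n) {i j : Fin m} (hi : n ≤ i) (hj : n ≤ j) :
    raiseOp q R i (lowerOp q R j f) ∈ invariantFunctions q R m n := by
  intro k hk
  have h : raiseOp q R k * lowerOp q R k * (raiseOp q R i * lowerOp q R j) =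
      raiseOp q R i * lowerOp q R j * (raiseOp q R k * lowerOp q R k) := by
    have h1 : ∀ a b c d : Fin m, raiseOp q R a * lowerOp q R b * (raiseOp q R c * lowerOp q R d) =
        raiseOp q R a * raiseOp q R c * (lowerOp q R b * lowerOp q R d) := fun a b c d => by
      rw [mul_assoc, ← mul_assoc (lowerOp q R b), lowerOp_mul_raiseOp hq, mul_assoc, mul_assoc]
    rw [h1, h1, raiseOp_mul_raiseOp hq k i (by omega), lowerOp_mul_lowerOp hq k j (by omega),
      smul_mul_assoc, mul_smul_comm, smul_smul, inv_mul_cancel₀ hq, one_smul]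
  have h2 := congrArg (fun T => T f) h
  simp only [Module.End.mul_apply] at h2
  rw [h2, hf k hk]

theorem orderedProd_apply_of_fixed {κ V : Type*} [LinearOrder κ] [Fintype κ] [AddCommGroup V]
    [Module ℂ V] (T : κ → Module.End ℂ V) (f : V) (h : ∀ i, T i f = f) :
    orderedProd T f = f := by
  rw [orderedProd]
  induction (Finset.univ : Finset κ).sort with
  | nil => rfl
  | cons a l ih => rw [List.map_cons, List.prod_cons, Module.End.mul_apply, ih, h]

theorem qDet_twist_apply_of_fixed (hq : q ≠ 0) {κ : Type*} [LinearOrder κ] [Fintype κ]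
    {e : κ → Fin m} (he : StrictMono e) (ε : κ → ℂ) (M : Matrix κ κ R)
    {f : (Fin m → ℤ) → R} (hf : ∀ k, raiseOp q R (e k) (lowerOp q R (e k) f) = f) :
    qDet 1 (Matrix.diagonal (fun i => ε i • (1 : Module.End ℂ ((Fin m → ℤ) → R))) -
        Matrix.of fun k l => leftMul m R (M k l) * (raiseOp q R (e k) * lowerOp q R (e l))) f =
      leftMul m R (qDetDiagSub q ε M) f := by
  rw [qDet_one_diagonal_sub_twist (q := q) (u := fun k => raiseOp q R (e k))
    (v := fun k => lowerOp q R (e k)) (fun i j hij => raiseOp_mul_raiseOp hq _ _ (he hij))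
    (fun i j => lowerOp_mul_raiseOp hq _ _) (leftMul m R) (fun r i => raiseOp_mul_leftMul r _)
    (fun r i => lowerOp_mul_leftMul r _), LinearMap.sum_apply, qDetDiagSub, map_sum,
    LinearMap.sum_apply]
  refine Finset.sum_congr rfl fun J _ => ?_
  rw [map_smul, LinearMap.smul_apply, LinearMap.smul_apply, Module.End.mul_apply,
    ← orderedProd_mul fun i j => lowerOp_mul_raiseOp hq _ _,
    orderedProd_apply_of_fixed (fun i : J => raiseOp q R (e i) * lowerOp q R (e i)) f
      fun i => hf i]

theorem orderedProd_fin_succ {T : Type*} [Ring T] (f : Fin (n + 1) → T) :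
    orderedProd f = (orderedProd fun k : Fin n => f k.castSucc) * f (Fin.last n) := by
  simp [orderedProd, Fin.sort_univ, List.finRange_succ_last, Function.comp_def]

theorem qDet_minor_map (q : ℂ) {κ ι : Type*} [LinearOrder κ] [LinearOrder ι] [Fintype κ]
    [Fintype ι] (e : κ ↪o ι) (M : Matrix ι ι R) (J : Finset κ) :
    qDet q (M.submatrix (fun i : J.map e.toEmbedding => (i : ι)) fun i => (i : ι)) =
      qDet q ((M.submatrix e e).submatrix (fun i : J => (i : κ)) fun i => (i : κ)) := by
  let g : J → J.map e.toEmbedding := fun i => ⟨e i, Finset.mem_map_of_mem _ i.2⟩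
  have hg : StrictMono g := fun a b hab => e.lt_iff_lt.2 hab
  have hs : Function.Surjective g := by
    rintro ⟨i, hi⟩
    obtain ⟨k, hk, rfl⟩ := Finset.mem_map.1 hi
    exact ⟨⟨k, hk⟩, rfl⟩
  rw [← qDet_orderIso q (hg.orderIsoOfSurjective g hs)]
  rfl

/-- The corner scalar is `δ_{ij}` here but `0` in `qDetBordered`. Subsets `J` omitting the last
index account for the `δ_{ij}` term; those containing it give the bordered determinant, with `u_i
v_j` left over. -/
theorem qDet_bordered_twist_apply (hq : q ≠ 0) (hn : n < m) (A : Matrix (Fin m) (Fin m) R)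
    {i j : Fin m} (hi : n ≤ i) (hj : n ≤ j) {f : (Fin m → ℤ) → R}
    (hf : f ∈ invariantFunctions q R m n) :
    qDet 1 ((twistedOneSub q A).submatrix
        (Fin.snoc (α := fun _ => Fin m) (Fin.castLE hn.le) i)
        (Fin.snoc (α := fun _ => Fin m) (Fin.castLE hn.le) j)) f =
      (if i = j then (1 : ℂ) else 0) • leftMul m R (qDetOneSub q (upperLeft n hn A)) f +
        leftMul m R (qDetBordered q n hn A i j) (raiseOp q R i (lowerOp q R j f)) := by
  set p : Fin (n + 1) → Fin m := Fin.snoc (α := fun _ => Fin m) (Fin.castLE hn.le) i with hp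
  set r : Fin (n + 1) → Fin m := Fin.snoc (α := fun _ => Fin m) (Fin.castLE hn.le) j with hr
  set δ : ℂ := if i = j then 1 else 0 with hδ
  have hp1 : ∀ k : Fin n, p k.castSucc = Fin.castLE hn.le k := fun k => by simp [hp]
  have hr1 : ∀ k : Fin n, r k.castSucc = Fin.castLE hn.le k := fun k => by simp [hr]
  have hp2 : p (Fin.last n) = i := by simp [hp]
  have hr2 : r (Fin.last n) = j := by simp [hr]
  have hpmono : StrictMono p := by
    intro a b hab
    induction b using Fin.lastCases with
    | last =>
      induction a using Fin.lastCases with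
      | last => exact absurd hab (lt_irrefl _)
      | cast a =>
        rw [hp1, hp2, Fin.lt_def, Fin.val_castLE]
        exact a.2.trans_le hi
    | cast b =>
      induction a using Fin.lastCases with
      | last => exact absurd hab (Fin.castSucc_lt_last b).not_gt
      | cast a =>
        rw [hp1, hp1]
        exact hab
  have hX : (twistedOneSub q A).submatrix p r =
      Matrix.diagonal (fun k => (Fin.snoc (α := fun _ => ℂ) (fun _ : Fin n => 1) δ k : ℂ) •
        (1 : Module.End ℂ ((Fin m → ℤ) → R))) -
      Matrix.of fun k l => leftMul m R (bordered n hn A i j k l) *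
        (raiseOp q R (p k) * lowerOp q R (r l)) := by
    ext1 k l
    simp only [twistedOneSub, Matrix.submatrix_apply, Matrix.sub_apply, Matrix.of_apply, bordered]
    congr 1
    induction k using Fin.lastCases with
    | last =>
      induction l using Fin.lastCases with
      | last => simp [hp2, hr2, Matrix.diagonal_apply, hδ]
      | cast l =>
        have h : i ≠ Fin.castLE hn.le l := fun h => by
          have := congrArg Fin.val h
          rw [Fin.val_castLE] at this
          omega
        rw [hp2, hr1, Matrix.diagonal_apply_ne _ h,
          Matrix.diagonal_apply_ne _ (Fin.castSucc_lt_last l).ne']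
    | cast k =>
      induction l using Fin.lastCases with
      | last =>
        have h : Fin.castLE hn.le k ≠ j := fun h => by
          have := congrArg Fin.val h
          rw [Fin.val_castLE] at this
          omega
        rw [hp1, hr2, Matrix.diagonal_apply_ne _ h,
          Matrix.diagonal_apply_ne _ (Fin.castSucc_lt_last k).ne]
      | cast l => simp [hp1, hr1, Matrix.diagonal_apply]
  -- The last factor acts first and gives another invariant function, which the remaining `u_k v_k`
  -- fix.
  have hJ : ∀ J : Finset (Fin (n + 1)),
      ((orderedProd fun k : J => raiseOp q R (p k)) * orderedProd fun k : J => lowerOp q R (r k)) f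
        = if Fin.last n ∈ J then raiseOp q R i (lowerOp q R j f) else f := by
    intro J
    rw [← orderedProd_piecewise_one J (fun k => raiseOp q R (p k)),
      ← orderedProd_piecewise_one J (fun k => lowerOp q R (r k)), ← orderedProd_mul,
      orderedProd_fin_succ, Module.End.mul_apply]
    · have hlast : (J.piecewise (fun k => raiseOp q R (p k)) 1 (Fin.last n) *
          J.piecewise (fun k => lowerOp q R (r k)) 1 (Fin.last n)) f =
            if Fin.last n ∈ J then raiseOp q R i (lowerOp q R j f) else f := by
        by_cases h : Fin.last n ∈ J <;> simp [h, hp2, hr2]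
      have hmem : (if Fin.last n ∈ J then raiseOp q R i (lowerOp q R j f) else f) ∈
          invariantFunctions q R m n := by
        split_ifs
        · exact raiseOp_lowerOp_mem_invariantFunctions hq hf hi hj
        · exact hf
      rw [hlast]
      refine orderedProd_apply_of_fixed _ _ fun k => ?_
      by_cases h : k.castSucc ∈ J
      · simpa [h, hp1, hr1] using hmem (Fin.castLE hn.le k) k.2
      · simp [h]
    · intro k l
      by_cases hk : k ∈ J <;> by_cases hl : l ∈ J <;> simp [hk, hl, lowerOp_mul_raiseOp hq]
  have hε : ∀ (c : ℂ) (J : Finset (Fin (n + 1))),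
      (∏ k ∈ Jᶜ, (Fin.snoc (α := fun _ => ℂ) (fun _ : Fin n => 1) c k : ℂ)) =
        if Fin.last n ∈ J then 1 else c := by
    intro c J
    split_ifs with h
    · refine Finset.prod_eq_one fun k hk => ?_
      induction k using Fin.lastCases with
      | last => exact absurd h (Finset.mem_compl.1 hk)
      | cast k => rw [Fin.snoc_castSucc]
    · rw [Finset.prod_eq_single (Fin.last n), Fin.snoc_last]
      · intro k _ hk
        induction k using Fin.lastCases with
        | last => exact absurd rfl hk
        | cast k => rw [Fin.snoc_castSucc]
      · exact fun h' => absurd (Finset.mem_compl.2 h) h'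
  rw [hX, qDet_one_diagonal_sub_twist (q := q) (u := fun k => raiseOp q R (p k))
    (v := fun k => lowerOp q R (r k)) (fun i j hij => raiseOp_mul_raiseOp hq _ _ (hpmono hij))
    (fun i j => lowerOp_mul_raiseOp hq _ _) (leftMul m R) (fun r i => raiseOp_mul_leftMul r _)
    (fun r i => lowerOp_mul_leftMul r _), LinearMap.sum_apply]
  have hlast : ∀ J : Finset (Fin n),
      Fin.last n ∉ J.map (Fin.castSuccOrderEmb (n := n)).toEmbedding := by
    intro J h
    obtain ⟨k, -, hk⟩ := Finset.mem_map.1 h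
    exact (Fin.castSucc_lt_last k).ne hk
  have hd : qDetOneSub q (upperLeft n hn A) = ∑ J : Finset (Fin (n + 1)),
      if Fin.last n ∈ J then 0 else (-1 : ℂ) ^ J.card • qDet q ((bordered n hn A i j).submatrix
        (fun k : J => (k : Fin (n + 1))) fun k => (k : Fin (n + 1))) := by
    rw [qDetOneSub, qDetDiagSub]
    refine Finset.sum_of_injOn (fun J => J.map (Fin.castSuccOrderEmb (n := n)).toEmbedding)
      (fun _ _ _ _ h => Finset.map_injective _ h) (fun _ _ => Finset.mem_coe.2 (Finset.mem_univ _))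
      ?_ ?_
    · intro J _ hJ
      refine if_pos (by_contra fun h => hJ ?_)
      refine ⟨Finset.univ.filter fun k => Fin.castSucc k ∈ J, by simp, ?_⟩
      ext k
      induction k using Fin.lastCases with
      | last => exact ⟨fun h' => absurd h' (hlast _), fun h' => absurd h' h⟩
      | cast k =>
        refine (Finset.mem_map' (Fin.castSuccOrderEmb (n := n)).toEmbedding).trans ?_
        simp
    · intro J _
      have hA : (bordered n hn A i j).submatrix Fin.castSuccOrderEmb Fin.castSuccOrderEmb =
          upperLeft n hn A := by
        ext k l
        exact congrArg₂ A (hp1 k) (hr1 l)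
      have h := qDet_minor_map q Fin.castSuccOrderEmb (bordered n hn A i j) J
      rw [hA] at h
      rw [if_neg (hlast J), Finset.card_map, Finset.prod_const_one, one_mul, ← h]
  have hb : qDetBordered q n hn A i j = ∑ J : Finset (Fin (n + 1)),
      if Fin.last n ∈ J then (-1 : ℂ) ^ J.card • qDet q ((bordered n hn A i j).submatrix
        (fun k : J => (k : Fin (n + 1))) fun k => (k : Fin (n + 1))) else 0 := by
    rw [qDetBordered, qDetDiagSub]
    refine Finset.sum_congr rfl fun J _ => ?_
    rw [hε]
    split_ifs <;> simp
  rw [hd, hb, map_sum, map_sum, LinearMap.sum_apply, LinearMap.sum_apply, Finset.smul_sum,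
    ← Finset.sum_add_distrib]
  refine Finset.sum_congr rfl fun J _ => ?_
  rw [LinearMap.smul_apply, Module.End.mul_apply, hJ, hε]
  split_ifs
  · simp
  · simp [smul_smul]

theorem qDet_fin_one (q : ℂ) (M : Matrix (Fin 1) (Fin 1) R) : qDet q M = M 0 0 := by
  have h : invCount (default : Equiv.Perm (Fin 1)) = 0 :=
    Finset.card_eq_zero.2 (Finset.filter_eq_empty_iff.2 fun p _ hp =>
      hp.1.ne (Subsingleton.elim _ _))
  rw [qDet_eq, Fintype.sum_unique, h, pow_zero, one_smul]
  simp [orderedProd]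

theorem upperLeft_twistedOneSub (hn : n < m) (A : Matrix (Fin m) (Fin m) R) :
    (twistedOneSub q A).submatrix (Fin.castLE hn.le) (Fin.castLE hn.le) =
      Matrix.diagonal (fun _ => (1 : ℂ) • (1 : Module.End ℂ ((Fin m → ℤ) → R))) -
        Matrix.of fun k l => leftMul m R (upperLeft n hn A k l) *
          (raiseOp q R (Fin.castLE hn.le k) * lowerOp q R (Fin.castLE hn.le l)) := by
  ext1 k l
  simp only [twistedOneSub, Matrix.submatrix_apply, Matrix.sub_apply]
  congr 1
  simp [Matrix.diagonal_apply]

/-- The Schur complement of the upper left block of `twistedOneSub q A`, where `G` is an inverse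
of that block. -/
noncomputable def schurOp (q : ℂ) (hn : n < m) (A : Matrix (Fin m) (Fin m) R)
    (G : Matrix (Fin n) (Fin n) (Module.End ℂ ((Fin m → ℤ) → R))) :
    Matrix {i : Fin m // n ≤ (i : ℕ)} {i : Fin m // n ≤ (i : ℕ)}
      (Module.End ℂ ((Fin m → ℤ) → R)) :=
  (twistedOneSub q A).submatrix Subtype.val Subtype.val -
    (twistedOneSub q A).submatrix Subtype.val (Fin.castLE hn.le) *
      (G * (twistedOneSub q A).submatrix (Fin.castLE hn.le) Subtype.val)

/-- The matrix `I - (c_{ij} u_i v_j)` of operators. -/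
noncomputable def sylvesterOp (q : ℂ) (hn : n < m) (A : Matrix (Fin m) (Fin m) R) :
    Matrix {i : Fin m // n ≤ (i : ℕ)} {i : Fin m // n ≤ (i : ℕ)}
      (Module.End ℂ ((Fin m → ℤ) → R)) :=
  Matrix.diagonal (fun _ => (1 : ℂ) • 1) - Matrix.of fun k l =>
    leftMul m R (qSylvester q n hn A k l) * (raiseOp q R (k : Fin m) * lowerOp q R (l : Fin m))

theorem sylvesterOp_apply (hn : n < m) (A : Matrix (Fin m) (Fin m) R)
    (i j : {i : Fin m // n ≤ (i : ℕ)}) (f : (Fin m → ℤ) → R) :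
    sylvesterOp q hn A i j f = (if (i : Fin m) = j then (1 : ℂ) else 0) • f -
      leftMul m R (qSylvester q n hn A i j) (raiseOp q R i (lowerOp q R j f)) := by
  rw [sylvesterOp, Matrix.sub_apply, LinearMap.sub_apply]
  congr 1
  by_cases h : i = j
  · simp [h]
  · simp [h, Subtype.val_injective.ne h]

theorem sylvesterOp_mem (hq : q ≠ 0) (hn : n < m) (A : Matrix (Fin m) (Fin m) R)
    (i j : {i : Fin m // n ≤ (i : ℕ)}) {f : (Fin m → ℤ) → R}
    (hf : f ∈ invariantFunctions q R m n) :
    sylvesterOp q hn A i j f ∈ invariantFunctions q R m n := by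
  rw [sylvesterOp_apply]
  exact Submodule.sub_mem _ (Submodule.smul_mem _ _ hf) (leftMul_mem_invariantFunctions
    (raiseOp_lowerOp_mem_invariantFunctions hq hf i.2 j.2) _)

theorem qDet_upperLeft_apply (hq : q ≠ 0) (hn : n < m) (A : Matrix (Fin m) (Fin m) R)
    {f : (Fin m → ℤ) → R} (hf : f ∈ invariantFunctions q R m n) :
    qDet 1 ((twistedOneSub q A).submatrix (Fin.castLE hn.le) (Fin.castLE hn.le)) f =
      leftMul m R (qDetOneSub q (upperLeft n hn A)) f := by
  rw [upperLeft_twistedOneSub]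
  exact qDet_twist_apply_of_fixed hq (e := Fin.castLE hn.le) (fun _ _ h => h) _ _
    fun k => hf _ k.2

/-- On invariant functions, the Schur complement acts as `I - (c_{ij} u_i v_j)`. -/
theorem schurOp_apply (hq : q ≠ 0) (hn : n < m) {A : Matrix (Fin m) (Fin m) R}
    (hA : IsQRightQuantum q A) (hd : IsUnit (qDetOneSub q (upperLeft n hn A)))
    {G : Matrix (Fin n) (Fin n) (Module.End ℂ ((Fin m → ℤ) → R))}
    (hG : (twistedOneSub q A).submatrix (Fin.castLE hn.le) (Fin.castLE hn.le) * G = 1)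
    (hinj : ∀ f g, qDet 1
      ((twistedOneSub q A).submatrix (Fin.castLE hn.le) (Fin.castLE hn.le)) f = qDet 1
      ((twistedOneSub q A).submatrix (Fin.castLE hn.le) (Fin.castLE hn.le)) g → f = g)
    (i j : {i : Fin m // n ≤ (i : ℕ)}) {f : (Fin m → ℤ) → R}
    (hf : f ∈ invariantFunctions q R m n) :
    schurOp q hn A G i j f = sylvesterOp q hn A i j f := by
  set X := twistedOneSub q A with hX
  set p : Fin (n + 1) → Fin m := Fin.snoc (α := fun _ => Fin m) (Fin.castLE hn.le) i.1 with hp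
  set r : Fin (n + 1) → Fin m := Fin.snoc (α := fun _ => Fin m) (Fin.castLE hn.le) j.1 with hr
  have hp1 : ∀ k : Fin n, p k.castSucc = Fin.castLE hn.le k := fun k => by simp [hp]
  have hr1 : ∀ k : Fin n, r k.castSucc = Fin.castLE hn.le k := fun k => by simp [hr]
  have hp2 : p (Fin.last n) = i := by simp [hp]
  have hr2 : r (Fin.last n) = j := by simp [hr]
  have h00 : (X.submatrix p r).submatrix Fin.castSucc Fin.castSucc =
      X.submatrix (Fin.castLE hn.le) (Fin.castLE hn.le) := by
    ext1 k l
    simp only [Matrix.submatrix_apply, hp1, hr1]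
  -- With a border of size one, the Schur complement is the single entry `schurOp q hn A G i j`.
  have hschur := qDet_one_schur (e₀ := Fin.castSucc) (e₁ := fun _ : Fin 1 => Fin.last n)
    (fun _ _ h => h) (fun a b h => absurd (Subsingleton.elim a b) h.ne)
    (fun a _ => Fin.castSucc_lt_last a)
    (fun k => by
      induction k using Fin.lastCases with
      | last => exact Or.inr ⟨0, rfl⟩
      | cast k => exact Or.inl ⟨k, rfl⟩)
    ((isManin_twistedOneSub hq hA).submatrix p r) (G := G) (by rw [← hX, h00, hG])
  rw [← hX, h00, qDet_fin_one] at hschur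
  have hentry : (((X.submatrix p r).submatrix (fun _ : Fin 1 => Fin.last n) (fun _ => Fin.last n) -
      (X.submatrix p r).submatrix (fun _ : Fin 1 => Fin.last n) Fin.castSucc *
        (G * (X.submatrix p r).submatrix Fin.castSucc fun _ : Fin 1 => Fin.last n)) :
          Matrix (Fin 1) (Fin 1) (Module.End ℂ ((Fin m → ℤ) → R))) 0 0 =
      schurOp q hn A G i j := by
    simp only [schurOp, Matrix.sub_apply, Matrix.mul_apply, Matrix.submatrix_apply, hp1, hr1, hp2,
      hr2, ← hX]
  rw [hentry] at hschur
  have h1 := qDet_bordered_twist_apply hq hn A i.2 j.2 hf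
  rw [← hX, ← hp, ← hr, hschur, Module.End.mul_apply] at h1
  -- Cancel `det X₀₀`: both sides become `δ_{ij} det_q(I - A₀) f` plus the bordered determinant
  -- times `u_i v_j f`. Injectivity on all functions is used, the left-hand function not being known
  -- to be invariant.
  apply hinj
  have hβ : qDetOneSub q (upperLeft n hn A) * qSylvester q n hn A i j =
      -qDetBordered q n hn A i j := by
    rw [qSylvester, Matrix.of_apply, mul_neg, Ring.mul_inverse_cancel_left _ _ hd]
  rw [h1, qDet_upperLeft_apply hq hn A (sylvesterOp_mem hq hn A i j hf), sylvesterOp_apply,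
    map_sub, map_smul, ← Module.End.mul_apply (leftMul m R _) (leftMul m R _), ← map_mul, hβ,
    map_neg, LinearMap.neg_apply, sub_neg_eq_add]

/-- Factors act from the right, and every intermediate function stays invariant, so they can be
replaced one at a time. -/
theorem qDet_schurOp_apply (hq : q ≠ 0) (hn : n < m) {A : Matrix (Fin m) (Fin m) R}
    {Y : Matrix {i : Fin m // n ≤ (i : ℕ)} {i : Fin m // n ≤ (i : ℕ)}
      (Module.End ℂ ((Fin m → ℤ) → R))}
    (hY : ∀ i j, ∀ f ∈ invariantFunctions q R m n, Y i j f = sylvesterOp q hn A i j f)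
    {f : (Fin m → ℤ) → R} (hf : f ∈ invariantFunctions q R m n) :
    qDet 1 Y f = qDet 1 (sylvesterOp q hn A) f := by
  rw [qDet_eq, qDet_eq, LinearMap.sum_apply, LinearMap.sum_apply]
  refine Finset.sum_congr rfl fun σ _ => ?_
  rw [LinearMap.smul_apply, LinearMap.smul_apply]
  congr 1
  have h : ∀ L : List {i : Fin m // n ≤ (i : ℕ)},
      (L.map fun j => Y (σ j) j).prod f = (L.map fun j => sylvesterOp q hn A (σ j) j).prod f ∧
      (L.map fun j => sylvesterOp q hn A (σ j) j).prod f ∈ invariantFunctions q R m n := by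
    intro L
    induction L with
    | nil => exact ⟨rfl, hf⟩
    | cons a l ih =>
      simp only [List.map_cons, List.prod_cons, Module.End.mul_apply]
      exact ⟨by rw [ih.1, hY _ _ _ ih.2], sylvesterOp_mem hq hn A _ _ ih.2⟩
  exact (h _).1

theorem single_zero_fixed (hq : q ≠ 0) (k : Fin m) :
    raiseOp q R k (lowerOp q R k (Pi.single 0 1)) = Pi.single (0 : Fin m → ℤ) (1 : R) := by
  funext x
  rw [raiseOp_lowerOp_self_apply hq]
  by_cases hx : x = 0
  · simp [hx]
  · simp [hx]

theorem qDetOneSub_eq_mul (hq : q ≠ 0) (hn : n < m) {A : Matrix (Fin m) (Fin m) R}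
    (hA : IsQRightQuantum q A) (hd : IsUnit (qDetOneSub q (upperLeft n hn A)))
    {G : Matrix (Fin n) (Fin n) (Module.End ℂ ((Fin m → ℤ) → R))}
    (hG : (twistedOneSub q A).submatrix (Fin.castLE hn.le) (Fin.castLE hn.le) * G = 1)
    (hinj : ∀ f g, qDet 1
      ((twistedOneSub q A).submatrix (Fin.castLE hn.le) (Fin.castLE hn.le)) f = qDet 1
      ((twistedOneSub q A).submatrix (Fin.castLE hn.le) (Fin.castLE hn.le)) g → f = g) :
    qDetOneSub q A =
      qDetOneSub q (upperLeft n hn A) * qDetOneSub q (qSylvester q n hn A) := by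
  -- At `0` all exponents of `q` vanish, so this function is fixed by every `u_k v_k`; evaluation at
  -- `0` recovers `r` from `r * f₀`.
  set f₀ : (Fin m → ℤ) → R := Pi.single 0 1 with hf₀
  have hmem : f₀ ∈ invariantFunctions q R m n := fun k _ => single_zero_fixed hq k
  have h1 : qDet 1 (twistedOneSub q A) f₀ = leftMul m R (qDetOneSub q A) f₀ :=
    qDet_twist_apply_of_fixed hq strictMono_id _ _ fun k => single_zero_fixed hq k
  have h2 : qDet 1 (sylvesterOp q hn A) f₀ =
      leftMul m R (qDetOneSub q (qSylvester q n hn A)) f₀ :=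
    qDet_twist_apply_of_fixed hq (e := Subtype.val) (fun _ _ h => h) _ _
      fun k => single_zero_fixed hq (k : Fin m)
  have hschur : qDet 1 (twistedOneSub q A) =
      qDet 1 ((twistedOneSub q A).submatrix (Fin.castLE hn.le) (Fin.castLE hn.le)) *
        qDet 1 (schurOp q hn A G) :=
    qDet_one_schur (e₀ := Fin.castLE hn.le)
      (e₁ := fun i : {i : Fin m // n ≤ (i : ℕ)} => (i : Fin m)) (fun _ _ h => h) (fun _ _ h => h)
      (fun a b => Fin.lt_def.2 (a.2.trans_le b.2))
      (fun i => (lt_or_ge (i : ℕ) n).imp (fun h => ⟨⟨i, h⟩, rfl⟩) fun h => ⟨⟨i, h⟩, rfl⟩)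
      (isManin_twistedOneSub hq hA) hG
  have h3 : qDet 1 (twistedOneSub q A) f₀ =
      leftMul m R (qDetOneSub q (upperLeft n hn A) * qDetOneSub q (qSylvester q n hn A)) f₀ := by
    rw [hschur, Module.End.mul_apply, qDet_schurOp_apply hq hn
      (fun i j f hf => schurOp_apply hq hn hA hd hG hinj i j hf) hmem, h2,
      qDet_upperLeft_apply hq hn _ (leftMul_mem_invariantFunctions hmem _), map_mul,
      Module.End.mul_apply]
  rw [h1] at h3
  have h5 := congrFun h3 0
  rwa [leftMul_apply, leftMul_apply, hf₀, Pi.single_eq_same, mul_one, mul_one] at h5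

/-- At each `x` the determinant multiplies `f x` from the left by a weighted sum of minors whose
empty minor has weight `1`, hence by a unit. -/
theorem qDet_upperLeft_injective (hq : q ≠ 0) (hn : n < m) (I : TwoSidedIdeal (SeriesAlg m))
    (f g : (Fin m → ℤ) → I.ringCon.Quotient)
    (h : qDet 1 ((twistedOneSub q (varMatrix I)).submatrix (Fin.castLE hn.le)
      (Fin.castLE hn.le)) f = qDet 1 ((twistedOneSub q (varMatrix I)).submatrix
        (Fin.castLE hn.le) (Fin.castLE hn.le)) g) : f = g := by
  funext x
  have hx := congrFun h x
  rw [upperLeft_twistedOneSub hn, qDet_twist_apply hq (e := Fin.castLE hn.le) (fun _ _ h => h),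
    qDet_twist_apply hq (e := Fin.castLE hn.le) (fun _ _ h => h)] at hx
  refine IsUnit.mul_left_cancel ?_ hx
  exact isUnit_sum_minors I q (Fin.castLE hn.le) (fun J : Finset (Fin n) =>
    (∏ i ∈ Jᶜ, (1 : ℂ)) * (-1) ^ J.card * ∏ i : J, q ^
      (∑ k ∈ Finset.Ioi (Fin.castLE hn.le (i : Fin n)), x k -
        ∑ k ∈ Finset.Iio (Fin.castLE hn.le (i : Fin n)), x k)) (by simp)

end Sylvester

theorem mainTheorem6 (q : ℂ) (hq : q ≠ 0) (m n : ℕ) (hn : n < m)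
    (I : TwoSidedIdeal (SeriesAlg m)) (hA : IsQRightQuantum q (varMatrix I)) :
    IsUnit (qDetOneSub q (upperLeft n hn (varMatrix I))) ∧
      Ring.inverse (qDetOneSub q (upperLeft n hn (varMatrix I))) * qDetOneSub q (varMatrix I) =
        qDetOneSub q (qSylvester q n hn (varMatrix I)) := by
  have hd : IsUnit (qDetOneSub q (upperLeft n hn (varMatrix I))) :=
    isUnit_sum_minors I q (Fin.castLE hn.le)
      (fun J : Finset (Fin n) => (∏ i ∈ Jᶜ, (1 : ℂ)) * (-1) ^ J.card) (by simp)
  obtain ⟨G, hG⟩ := exists_right_inverse_twistedOneSub hq I (Fin.castLE_injective hn.le)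
  refine ⟨hd, ?_⟩
  rw [qDetOneSub_eq_mul hq hn hA hd hG (qDet_upperLeft_injective hq hn I),
    Ring.inverse_mul_cancel_left _ _ hd]
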